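/- Let $p\ge q\ge 2$ be integers with $p+q$ even and $(p,q)\ne(2,2)$, and put $n=p+q-2$. Write points of $\mathbb R^n$ as $z=(z',z'')$ with $z'\in\mathbb R^{p-1}$, $z''\in\mathbb R^{q-1}$, and points of $M=S^{p-1}\times S^{q-1}\subset\mathbb R^p\times\mathbb R^q$ as $u=(u_0,u',u'',u_{n+1})$ with $u'\in\mathbb R^{p-1}$, $u''\in\mathbb R^{q-1}$, $u_0^2+|u'|^2=1=|u''|^2+u_{n+1}^2$. Put $$\iota(z)=\Bigl(1-\tfrac{|z'|^2-|z''|^2}{4},\,z',\,z'',\,1+\tfrac{|z'|^2-|z''|^2}{4}\Bigr),\qquad \tau(z)=\Bigl(\bigl(1-\tfrac{|z'|^2-|z''|^2}{4}\bigr)^2+|z'|^2\Bigr)^{1/2},$$ $\Psi(z)=\tau(z)^{-1}\iota(z)\in M$, and $(\Psi^*F)(z)=\tau(z)^{-\frac{p+q-4}{2}}F(\Psi(z))$ for $F:M\to\mathbb C$. Let $F_0:M\to\mathbb C$ be the generating function $$F_0(u)=\sigma(u)\;{}_2F_1\Bigl(\tfrac{q-p}{4},\tfrac{p+q-4}{4};\tfrac{q-1}{2};|u''|^2\Bigr),\qquad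 \sigma(u)=\begin{cases}1,&u_{n+1}\ge 0,\\(-1)^{\frac{p-q}{2}},&u_{n+1}<0.\end{cases}$$ Let $\delta(Q)$ be the measure on the cone $C=\{\zeta=(\zeta',\zeta'')\in\mathbb R^n:|\zeta'|=|\zeta''|\}$ given by $$\int\varphi\,\delta(Q)=\frac12\int_0^\infty\int_{S^{p-2}}\int_{S^{q-2}}\varphi(s\omega,s\omega')\,s^{n-3}\,ds\,d\omega\,d\omega',$$ let $\mathcal F$ be the Fourier transform $(\mathcal Ff)(\zeta)=\int_{\mathbb R^n}f(z)e^{i\langle z,\zeta\rangle}dz$, extended to tempered distributions by duality, and let $K_\nu$ be the modified Bessel function of the second kind. Then $\Psi^*F_0$ and $|\zeta'|^{\frac{3-q}{2}}K_{\frac{q-3}{2}}(2|\zeta'|)\,\delta(Q)$ define tempered distributions on $\mathbb R^n$ (by absolutely convergent integrals against Schwartz functions), and $$\mathcal F\Psi^*F_0=(2\pi)^{\frac{p+q-2}{2}}\,2^{\frac{p+q}{2}}\,\frac{\Gamma(\frac{q-1}{2})}{\Gamma(\frac{p+q-4}{2})}\;|\zeta'|^{\frac{3-q}{2}}K_{\frac{q-3}{2}}(2|\zeta'|)\,\delta(Q).$$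 -/

import Mathlib

open MeasureTheory Filter Topology
open scoped SchwartzMap FourierTransform

noncomputable section

namespace ConformalCone

/-! ### Bessel functions (real order, positive argument) -/

/-- The modified Bessel function of the first kind,
`I_ν(x) = ∑ (x/2)^(ν+2m) / (m! Γ(ν+m+1))`, for `x > 0`.  At the poles of `Γ` the value of
`Real.Gamma` is `0`, so that `1/Γ` is `0` there, as it should be. -/
def besselI (ν x : ℝ) : ℝ :=
  ∑' m : ℕ, (x / 2) ^ (ν + 2 * (m : ℝ)) / ((m.factorial : ℝ) * Real.Gamma (ν + m + 1))

/-- The modified Bessel function of the second kind,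
`K_ν(x) = (π/2) (I_{-ν}(x) - I_ν(x)) / sin (ν π)`, for `x > 0`; as usual the right-hand side is
understood as a limit in the order (it is continuous in `ν` outside the integers, and the
singularities at the integers are removable). -/
def besselK (ν x : ℝ) : ℝ :=
  limUnder (𝓝[≠] ν) fun a : ℝ =>
    Real.pi / 2 * ((besselI (-a) x - besselI a x) / Real.sin (a * Real.pi))

/-! ### The flat space `ℝ^n = ℝ^(p-1) × ℝ^(q-1)` and the compact space `M = S^(p-1) × S^(q-1)` -/

/-- `ℝ^n`, `n = (p-1) + (q-1) = p + q - 2`, with its Euclidean structure. -/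
abbrev Flat (p q : ℕ) : Type := EuclideanSpace ℝ (Fin (p - 1) ⊕ Fin (q - 1))

variable {p q : ℕ}

/-- The point `(z', z'')`. -/
def pair (x : EuclideanSpace ℝ (Fin (p - 1))) (y : EuclideanSpace ℝ (Fin (q - 1))) : Flat p q :=
  WithLp.toLp 2 (Sum.elim x y)

/-- The component `z'` of `z = (z', z'')`. -/
def fstPart (z : Flat p q) : EuclideanSpace ℝ (Fin (p - 1)) :=
  WithLp.toLp 2 fun i => z (Sum.inl i)

/-- The component `z''` of `z = (z', z'')`. -/
def sndPart (z : Flat p q) : EuclideanSpace ℝ (Fin (q - 1)) :=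
  WithLp.toLp 2 fun j => z (Sum.inr j)

/-- `ℝ^(p+q)`, with coordinates `(u₀, u', u'', u_{n+1})`: the first two make up `ℝ^p`, the last
two `ℝ^q`. -/
abbrev Ambient (p q : ℕ) : Type :=
  ℝ × EuclideanSpace ℝ (Fin (p - 1)) × EuclideanSpace ℝ (Fin (q - 1)) × ℝ

/-- `M = S^(p-1) × S^(q-1)` inside `ℝ^p × ℝ^q`. -/
def M (p q : ℕ) : Set (Ambient p q) :=
  {u | u.1 ^ 2 + ‖u.2.1‖ ^ 2 = 1 ∧ ‖u.2.2.1‖ ^ 2 + u.2.2.2 ^ 2 = 1}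

/-- The embedding `ι` of `ℝ^n` into the cone `|x| = |y|` of `ℝ^p × ℝ^q`. -/
def iota (z : Flat p q) : Ambient p q :=
  (1 - (‖fstPart z‖ ^ 2 - ‖sndPart z‖ ^ 2) / 4, fstPart z, sndPart z,
    1 + (‖fstPart z‖ ^ 2 - ‖sndPart z‖ ^ 2) / 4)

/-- The conformal factor `τ(z)`: the norm of the `ℝ^p`-component of `ι(z)`. -/
def tau (z : Flat p q) : ℝ :=
  Real.sqrt ((1 - (‖fstPart z‖ ^ 2 - ‖sndPart z‖ ^ 2) / 4) ^ 2 + ‖fstPart z‖ ^ 2)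

theorem tau_sq (z : Flat p q) :
    tau z ^ 2 = (1 - (‖fstPart z‖ ^ 2 - ‖sndPart z‖ ^ 2) / 4) ^ 2 + ‖fstPart z‖ ^ 2 :=
  Real.sq_sqrt (by positivity)

theorem tau_pos (z : Flat p q) : 0 < tau z := by
  have h : 0 < tau z ^ 2 := by
    rw [tau_sq]
    nlinarith [sq_nonneg (1 + (‖fstPart z‖ ^ 2 - ‖sndPart z‖ ^ 2) / 4),
      sq_nonneg (1 - (‖fstPart z‖ ^ 2 - ‖sndPart z‖ ^ 2) / 4), sq_nonneg ‖fstPart z‖,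
      sq_nonneg ‖sndPart z‖]
  have h0 : 0 ≤ tau z := Real.sqrt_nonneg _
  exact lt_of_le_of_ne h0 fun h1 => by simp [← h1] at h

theorem tau_inv_smul_iota_mem (z : Flat p q) : (tau z)⁻¹ • iota z ∈ M p q := by
  have h := tau_sq z
  have h0 := (tau_pos z).ne'
  have h1 : 0 ≤ (tau z)⁻¹ := inv_nonneg.2 (tau_pos z).le
  simp only [M, iota, Set.mem_ofPred_eq, Prod.smul_mk, smul_eq_mul, norm_smul, Real.norm_eq_abs,
    abs_of_nonneg h1, mul_pow, ← mul_add, inv_pow]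
  constructor
  · rw [← h]
    exact inv_mul_cancel₀ (pow_ne_zero 2 h0)
  · rw [show ‖sndPart z‖ ^ 2 + (1 + (‖fstPart z‖ ^ 2 - ‖sndPart z‖ ^ 2) / 4) ^ 2 = tau z ^ 2 by
      rw [h]; ring]
    exact inv_mul_cancel₀ (pow_ne_zero 2 h0)

/-- The conformal map `Ψ : ℝ^n → M`, `z ↦ τ(z)⁻¹ ι(z)`. -/
def Psi (z : Flat p q) : M p q := ⟨(tau z)⁻¹ • iota z, tau_inv_smul_iota_mem z⟩

/-- The twisted pull-back `(Ψ_λ^* F)(z) = τ(z)^(-λ) F(Ψ(z))`. -/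
def twistedPullback (l : ℝ) (F : M p q → ℂ) (z : Flat p q) : ℂ :=
  ((tau z ^ (-l) : ℝ) : ℂ) * F (Psi z)

/-- The generating function: for `u_{n+1} ≥ 0` it is
`₂F₁((q-p)/4, (p+q-4)/4; (q-1)/2; |u''|²)`, and it is extended to `M` with the parity
`F₀(-u) = (-1)^((p-q)/2) F₀(u)` of the functions in the minimal `K`-type
(restrictions of homogeneous harmonic polynomials of degree `(p-q)/2` on `ℝ^q`). -/
def generatingFunction (p q : ℕ) (u : M p q) : ℂ :=
  (((if 0 ≤ u.1.2.2.2 then 1 else (-1) ^ ((p - q) / 2)) *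
    ordinaryHypergeometric (((q : ℝ) - p) / 4) (((p : ℝ) + q - 4) / 4) (((q : ℝ) - 1) / 2)
      (‖u.1.2.2.1‖ ^ 2) : ℝ) : ℂ)

/-! ### The cone `C` with its measure `δ(Q)` -/

/-- The canonical measure `dμ = δ(Q)` on the cone `C = {|ζ'| = |ζ''|}`, as a measure on `ℝ^n`:
`∫ φ dμ = (1/2) ∫₀^∞ ∫_{S^(p-2)} ∫_{S^(q-2)} φ(sω, sω') s^(n-3) ds dω dω'`
(`volumeIoiPow k` is `s^k ds` on `(0, ∞)`, `volume.toSphere` is the surface measure; `n - 3` is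
`p + q - 5`). -/
def deltaQ (p q : ℕ) : Measure (Flat p q) :=
  (2⁻¹ : ENNReal) •
    ((Measure.volumeIoiPow (p + q - 5)).prod
      ((volume : Measure (EuclideanSpace ℝ (Fin (p - 1)))).toSphere.prod
        (volume : Measure (EuclideanSpace ℝ (Fin (q - 1)))).toSphere)).map
      fun t => pair (t.1.1 • t.2.1.1) (t.1.1 • t.2.2.1)

/-! ### Tempered distributions and the Fourier transform -/

section Distributions

variable {E : Type*} [NormedAddCommGroup E] [InnerProductSpace ℝ E] [FiniteDimensional ℝ E]
  [MeasurableSpace E] [BorelSpace E]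

/-- The tempered distribution `T` is `f dμ`, that is, `T(φ) = ∫ f φ dμ`, where the integral
converges absolutely, for all Schwartz functions `φ`. -/
def IsGivenBy (T : 𝓢'(E, ℂ)) (f : E → ℂ) (μ : Measure E) : Prop :=
  ∀ φ : 𝓢(E, ℂ), Integrable (fun x => f x * φ x) μ ∧ T φ = ∫ x, f x * φ x ∂μ

/-- The homothety `ζ ↦ ζ / (2π)`. -/
def homothety (E : Type*) [NormedAddCommGroup E] [InnerProductSpace ℝ E] : E ≃L[ℝ] E :=
  ContinuousLinearEquiv.smulLeft (Units.mk0 (2 * Real.pi)⁻¹ (by positivity))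

/-- The Fourier transform `(𝓕 f)(ζ) = ∫ f(z) e^{i⟨z, ζ⟩} dz` on Schwartz functions
(see `fourierS_apply`), obtained from Mathlib's inverse Fourier transform
`w ↦ ∫ f(z) e^{2πi⟨z, w⟩} dz` by rescaling. -/
def fourierS (E : Type*) [NormedAddCommGroup E] [InnerProductSpace ℝ E] [FiniteDimensional ℝ E]
    [MeasurableSpace E] [BorelSpace E] : 𝓢(E, ℂ) →L[ℂ] 𝓢(E, ℂ) :=
  (SchwartzMap.compCLMOfContinuousLinearEquiv ℂ (homothety E)).comp
    (FourierTransform.fourierInvCLM ℂ 𝓢(E, ℂ))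

theorem fourierS_apply (f : 𝓢(E, ℂ)) (ζ : E) :
    fourierS E f ζ = ∫ z, f z * Complex.exp (Complex.I * (inner ℝ z ζ : ℝ)) := by
  have h : fourierS E f ζ = (𝓕⁻ (f : E → ℂ)) ((2 * Real.pi)⁻¹ • ζ) := by
    rw [← SchwartzMap.fourierInv_coe]; rfl
  rw [h, Real.fourierInv_eq']
  refine integral_congr_ae (Eventually.of_forall fun z => ?_)
  have hpi : Real.pi ≠ 0 := Real.pi_ne_zero
  simp only [smul_eq_mul, inner_smul_right]
  rw [mul_comm]
  congr 2
  rw [show 2 * Real.pi * ((2 * Real.pi)⁻¹ * inner ℝ z ζ) = inner ℝ z ζ by field_simp]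
  ring

/-- The Fourier transform on tempered distributions, `(𝓕 T)(φ) = T(𝓕 φ)`. -/
def fourierD (T : 𝓢'(E, ℂ)) : 𝓢'(E, ℂ) := PointwiseConvergenceCLM.precomp ℂ (fourierS E) T

end Distributions

end ConformalCone

end

/-!
The distribution `U` is obtained from its Fourier transform. Put `ν = (q-3)/2`, `λ = (p+q-4)/2`,
`c = (q-1)/2` and `l = (p-q)/2`. The measure `|ζ'|^{-ν} K_ν(2|ζ'|) δ(Q)` is finite, since `K_ν` decays
exponentially and its singularity at the origin is integrable against `δ(Q)`. So its Fourier
transform `coneFourier` is a bounded continuous function, and the claim is that this function is a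
multiple of the twisted pull-back of the generating function (`exists_fourierD_eq_smul` is the
Fubini argument that goes from functions back to distributions).

* In polar coordinates `coneFourier z` is the integral over `s > 0` of `K_ν(2s)` times the Fourier
  transforms of the two spheres at `s z'` and `s z''`, which are Bessel functions
  (`sphereFourier_eq`). The integral representation
  `2 s^ν K_ν(2s) = ∫ exp(-t - s²/t) t^{ν-1} dt` (`besselK_two_mul`) and an identity for Laguerre
  polynomials give a product formula
  (`macdonaldIntegral_mul_normalizedBesselJ`), which turns the product of `K_ν(2s)` with the Bessel
  function of `s z''` into an integral over `t` of `exp(-t - s²/t)` times a Bessel function of `t z''`.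
  Then the variable `s` occurs only in a Gaussian, which is integrated against the Bessel function
  of `s z'`, and what is left is the Laplace transform at `W = 1 + (|z'|² - |z''|²)/4` of a Bessel
  function times a power. It is the hypergeometric function
  `W^{-λ} ₂F₁(λ/2, (λ+1)/2; c; -|z''|²/W²)` (`integral_macdonaldIntegral_mul_sphereFourier`). The product
  formula converges only for small `z''`.
* Since `τ² = W² + |z''|²`, Pfaff's transformation identifies this function with
  `τ^{-λ-l} P(W, |z''|²)`, where `P` is the zonal harmonic polynomial of degree `l` on `ℝ^q`. The same
  transformation, in the terminating case, identifies the twisted pull-back of the generating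
  function with `τ^{-λ-l} P(W, |z''|²)`, for all `z` with `W ≠ 0`; the sign of the generating function
  on `u_{n+1} < 0` is the parity of `P` in `W`.
* Since the measure on the cone has exponential moments, `coneFourier` is real-analytic on every
  ray, and so is `τ^{-λ-l} P(W, |z''|²)`: the two agree everywhere (`coneFourier_eq`).

The Bessel function `K_ν` is given by `I_{±ν}` and a limit in the order. To match it with the integral
representation for orders in `(0, 1)`, the pair of functions of orders `a` and `1 - a` is
characterized by a linear first order system and its limits at the origin
(`eq_zero_of_macdonald_system`); differentiation lowers the order by one, and continuity in the
order gives the integers.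
-/

namespace ConformalCone

open Set Real

/-! ### The Macdonald integral -/

/-- The integral `∫₀^∞ e^{-t-y/t} t^{μ-1} dt`, equal to `2 y^{μ/2} K_μ(2√y)` for `y > 0`. -/
noncomputable def macdonaldIntegral (μ y : ℝ) : ℝ :=
  ∫ t in Ioi (0 : ℝ), exp (-t - y / t) * t ^ (μ - 1)

theorem continuousOn_exp_neg_sub_div_mul_rpow (r y μ : ℝ) :
    ContinuousOn (fun t : ℝ => exp (-(r * t) - y / t) * t ^ (μ - 1)) (Ioi 0) := by
  refine ContinuousOn.mul (Real.continuous_exp.comp_continuousOn ?_) ?_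
  · exact ContinuousOn.sub (by fun_prop)
      (continuousOn_const.div continuousOn_id fun t ht => (ne_of_gt ht))
  · exact continuousOn_id.rpow_const fun t ht => Or.inl (ne_of_gt ht)

theorem aestronglyMeasurable_exp_neg_sub_div_mul_rpow (r y μ : ℝ) :
    AEStronglyMeasurable (fun t : ℝ => exp (-(r * t) - y / t) * t ^ (μ - 1))
      (volume.restrict (Ioi 0)) :=
  (continuousOn_exp_neg_sub_div_mul_rpow r y μ).aestronglyMeasurable measurableSet_Ioi

theorem integrableOn_exp_neg_mul_rpow {r : ℝ} (hr : 0 < r) {μ : ℝ} (hμ : 0 < μ) :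
    IntegrableOn (fun t : ℝ => exp (-(r * t)) * t ^ (μ - 1)) (Ioi 0) := by
  have h := integrableOn_rpow_mul_exp_neg_mul_rpow (p := 1) (s := μ - 1) (b := r)
    (by linarith) one_pos hr
  refine h.congr_fun (fun t ht => ?_) measurableSet_Ioi
  simp only [rpow_one]
  rw [mul_comm, neg_mul]

/-- The factor `exp (-y/t)` makes up for any negative power of `t` at the origin. -/
theorem integrableOn_exp_neg_sub_div_mul_rpow {r y : ℝ} (hr : 0 < r) (hy : 0 < y) (μ : ℝ) :
    IntegrableOn (fun t : ℝ => exp (-(r * t) - y / t) * t ^ (μ - 1)) (Ioi 0) := by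
  obtain ⟨n, hn⟩ := exists_nat_gt (-μ)
  have h := (integrableOn_exp_neg_mul_rpow hr (μ := μ + n) (by linarith)).const_mul
    (n.factorial / y ^ n)
  refine Integrable.mono' h (aestronglyMeasurable_exp_neg_sub_div_mul_rpow r y μ) ?_
  filter_upwards [ae_restrict_mem measurableSet_Ioi] with t ht
  have ht : 0 < t := ht
  have h1 := Real.pow_div_factorial_le_exp (x := y / t) (by positivity) n
  have h2 : exp (-(y / t)) ≤ n.factorial / y ^ n * t ^ n := by
    rw [Real.exp_neg, div_mul_eq_mul_div, inv_le_comm₀ (exp_pos _) (by positivity)]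
    refine le_trans (le_of_eq ?_) h1
    rw [div_pow]; field_simp
  rw [Real.norm_of_nonneg (by positivity), sub_eq_add_neg, Real.exp_add]
  calc exp (-(r * t)) * exp (-(y / t)) * t ^ (μ - 1)
      ≤ exp (-(r * t)) * (n.factorial / y ^ n * t ^ n) * t ^ (μ - 1) := by gcongr
    _ = _ := by
      rw [show μ + n - 1 = (μ - 1) + n by ring, rpow_add ht, rpow_natCast]; ring

theorem integrableOn_macdonaldIntegral {y : ℝ} (hy : 0 < y) (μ : ℝ) :
    IntegrableOn (fun t : ℝ => exp (-t - y / t) * t ^ (μ - 1)) (Ioi 0) := by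
  simpa using integrableOn_exp_neg_sub_div_mul_rpow one_pos hy μ

theorem hasDerivAt_macdonaldIntegral {y : ℝ} (hy : 0 < y) (μ : ℝ) :
    HasDerivAt (macdonaldIntegral μ) (-macdonaldIntegral (μ - 1) y) y := by
  have key := (hasDerivAt_integral_of_dominated_loc_of_deriv_le
    (μ := volume.restrict (Ioi (0 : ℝ))) (x₀ := y) (s := Ioi (y / 2))
    (F := fun y t => exp (-t - y / t) * t ^ (μ - 1))
    (F' := fun y t => -(exp (-t - y / t) * t ^ (μ - 1 - 1)))
    (bound := fun t => exp (-t - (y / 2) / t) * t ^ (μ - 1 - 1))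
    (Ioi_mem_nhds (by linarith)) ?_ (integrableOn_macdonaldIntegral hy μ) ?_ ?_ ?_ ?_).2
  · convert! key using 1
    simp only [macdonaldIntegral]
    rw [integral_neg]
  · refine Eventually.of_forall fun x => ?_
    simpa using aestronglyMeasurable_exp_neg_sub_div_mul_rpow 1 x μ
  · have h := aestronglyMeasurable_exp_neg_sub_div_mul_rpow 1 y (μ - 1)
    simp only [one_mul] at h
    exact h.neg
  · filter_upwards [ae_restrict_mem measurableSet_Ioi] with t ht x hx
    have ht : 0 < t := ht
    have hx : y / 2 < x := hx
    rw [norm_neg, Real.norm_of_nonneg (by positivity)]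
    gcongr
  · exact integrableOn_macdonaldIntegral (by linarith) _
  · filter_upwards [ae_restrict_mem measurableSet_Ioi] with t ht x _
    have ht : 0 < t := ht
    have h1 : HasDerivAt (fun x => -t - x / t) (-(1 / t)) x := by
      simpa using ((hasDerivAt_id x).div_const t).const_sub (-t)
    have h2 := h1.exp.mul_const (t ^ (μ - 1))
    convert! h2 using 1
    rw [rpow_sub_one ht.ne' (μ - 1)]
    ring

/-- The substitution `t ↦ y / t`. -/
theorem macdonaldIntegral_neg {y : ℝ} (hy : 0 < y) (μ : ℝ) :
    macdonaldIntegral (-μ) y = y ^ (-μ) * macdonaldIntegral μ y := by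
  have h1 := integral_comp_rpow_Ioi (fun t => exp (-t - y / t) * t ^ (-μ - 1))
    (p := -1) (by norm_num)
  have h2 := integral_comp_mul_left_Ioi
    (fun t => (|(-1 : ℝ)| * t ^ ((-1 : ℝ) - 1)) • (exp (-(t ^ (-1 : ℝ)) - y / t ^ (-1 : ℝ)) *
      (t ^ (-1 : ℝ)) ^ (-μ - 1))) 0 (b := y⁻¹) (by positivity)
  rw [mul_zero, h1] at h2
  rw [smul_eq_mul, inv_inv, eq_comm, ← eq_inv_mul_iff_mul_eq₀ hy.ne'] at h2
  rw [macdonaldIntegral, h2, macdonaldIntegral, ← integral_const_mul, ← integral_const_mul]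
  refine setIntegral_congr_fun measurableSet_Ioi fun t ht => ?_
  have ht : 0 < t := ht
  simp only [smul_eq_mul, abs_neg, abs_one, one_mul]
  have e1 : (y⁻¹ * t) ^ (-1 : ℝ) = y / t := by
    rw [rpow_neg_one]; field_simp
  have e2 : (y⁻¹ * t) ^ ((-1 : ℝ) - 1) = (y / t) ^ 2 := by
    rw [rpow_sub_one (by positivity), rpow_neg_one]; field_simp
  have e3 : y / (y / t) = t := by field_simp
  rw [e1, e2, e3, rpow_sub_one (by positivity), div_rpow hy.le ht.le, rpow_neg ht.le,
    rpow_sub_one ht.ne']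
  rw [show -(y / t) - t = -t - y / t by ring]
  have : 0 < t ^ μ := by positivity
  field_simp

/-- Differentiating `H_μ(y) = y^μ H_{-μ}(y)` spares the boundary terms of an integration
by parts. -/
theorem macdonaldIntegral_add_one {y : ℝ} (hy : 0 < y) (μ : ℝ) :
    macdonaldIntegral (μ + 1) y = y * macdonaldIntegral (μ - 1) y + μ * macdonaldIntegral μ y := by
  have h1 := hasDerivAt_macdonaldIntegral hy μ
  have h2 : HasDerivAt (fun x => x ^ μ * macdonaldIntegral (-μ) x)
      (μ * y ^ (μ - 1) * macdonaldIntegral (-μ) y + y ^ μ * -macdonaldIntegral (-μ - 1) y) y :=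
    (Real.hasDerivAt_rpow_const (Or.inl hy.ne')).mul (hasDerivAt_macdonaldIntegral hy (-μ))
  have h3 : (fun x => x ^ μ * macdonaldIntegral (-μ) x) =ᶠ[𝓝 y] macdonaldIntegral μ := by
    filter_upwards [lt_mem_nhds hy] with x hx
    rw [macdonaldIntegral_neg hx, ← mul_assoc, ← rpow_add hx]; simp
  have h4 := h1.unique (h2.congr_of_eventuallyEq h3.symm)
  rw [show -μ - 1 = -(μ + 1) by ring, macdonaldIntegral_neg hy, macdonaldIntegral_neg hy,
    rpow_neg hy.le, rpow_neg hy.le, rpow_sub_one hy.ne', rpow_add_one hy.ne'] at h4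
  have : 0 < y ^ μ := by positivity
  field_simp at h4
  linarith

theorem continuous_macdonaldIntegral_left {y : ℝ} (hy : 0 < y) :
    Continuous fun μ => macdonaldIntegral μ y := by
  refine continuous_iff_continuousAt.2 fun μ => ?_
  refine continuousAt_of_dominated (F := fun μ t => exp (-t - y / t) * t ^ (μ - 1))
    (bound := fun t => exp (-t - y / t) * t ^ (μ + 1 - 1) + exp (-t - y / t) * t ^ (μ - 1 - 1))
    ?_ ?_ ?_ ?_
  · refine Eventually.of_forall fun x => ?_
    simpa using aestronglyMeasurable_exp_neg_sub_div_mul_rpow 1 y x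
  · filter_upwards [Ioo_mem_nhds (show μ - 1 < μ by linarith) (show μ < μ + 1 by linarith)]
      with x hx
    filter_upwards [ae_restrict_mem measurableSet_Ioi] with t ht
    have ht : 0 < t := ht
    rw [Real.norm_of_nonneg (by positivity), ← mul_add]
    gcongr
    rcases le_total 1 t with h | h
    · have : t ^ (x - 1) ≤ t ^ (μ + 1 - 1) := rpow_le_rpow_of_exponent_le h (by linarith [hx.2])
      have : 0 < t ^ (μ - 1 - 1) := by positivity
      linarith
    · have : t ^ (x - 1) ≤ t ^ (μ - 1 - 1) :=
        rpow_le_rpow_of_exponent_ge ht h (by linarith [hx.1])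
      have : 0 < t ^ (μ + 1 - 1) := by positivity
      linarith
  · exact (integrableOn_macdonaldIntegral hy _).add (integrableOn_macdonaldIntegral hy _)
  · filter_upwards [ae_restrict_mem measurableSet_Ioi] with t ht
    have ht : 0 < t := ht
    exact continuousAt_const.mul
      ((continuousAt_const.rpow (by fun_prop) (Or.inl ht.ne')))

theorem tendsto_macdonaldIntegral_zero {μ : ℝ} (hμ : 0 < μ) :
    Tendsto (macdonaldIntegral μ) (𝓝[>] 0) (𝓝 (Gamma μ)) := by
  rw [Real.Gamma_eq_integral hμ]
  refine tendsto_integral_filter_of_dominated_convergence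
    (bound := fun t => exp (-t) * t ^ (μ - 1)) ?_ ?_ ?_ ?_
  · refine Eventually.of_forall fun x => ?_
    simpa using aestronglyMeasurable_exp_neg_sub_div_mul_rpow 1 x μ
  · filter_upwards [self_mem_nhdsWithin] with x hx
    have hx : 0 < x := hx
    filter_upwards [ae_restrict_mem measurableSet_Ioi] with t ht
    have ht : 0 < t := ht
    rw [Real.norm_of_nonneg (by positivity)]
    gcongr
    have : 0 < x / t := by positivity
    linarith
  · have h := integrableOn_exp_neg_mul_rpow one_pos hμ
    simp only [one_mul] at h
    exact h
  · refine ae_of_all _ fun t => ?_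
    have h := Continuous.tendsto
      (show Continuous fun x => exp (-t - x / t) * t ^ (μ - 1) by fun_prop) 0
    simp only [zero_div, sub_zero] at h
    exact h.mono_left nhdsWithin_le_nhds

theorem macdonaldIntegral_nonneg (μ y : ℝ) : 0 ≤ macdonaldIntegral μ y :=
  setIntegral_nonneg measurableSet_Ioi fun _ ht =>
    mul_nonneg (exp_pos _).le (rpow_nonneg (le_of_lt ht) _)

/-! ### The Macdonald integral and the Bessel function `K_ν` -/

/-- The entire function `∑ y^m / (m! Γ(a+m+1))`, so that `I_a(2s) = s^a R_a(s²)`. -/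
noncomputable def besselSeries (a y : ℝ) : ℝ :=
  ∑' m : ℕ, y ^ m / ((m.factorial : ℝ) * Gamma (a + m + 1))

theorem exists_bound_of_antitone_from {v : ℕ → ℝ} (N : ℕ) (hv : ∀ m, N ≤ m → v (m + 1) ≤ v m) :
    ∃ C, ∀ m, v m ≤ C := by
  have htail : ∀ k : ℕ, v (N + k) ≤ v N := by
    intro k
    induction k with
    | zero => simp
    | succ k ih => exact (hv (N + k) (by omega)).trans ih
  have hsum : ∀ m ∈ Finset.range (N + 1), v m ≤ ∑ m ∈ Finset.range (N + 1), |v m| := fun m hm =>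
    (le_abs_self _).trans (Finset.single_le_sum (f := fun m => |v m|) (fun _ _ => abs_nonneg _) hm)
  refine ⟨∑ m ∈ Finset.range (N + 1), |v m|, fun m => ?_⟩
  rcases le_or_gt m N with h | h
  · exact hsum m (Finset.mem_range.2 (by omega))
  · obtain ⟨k, rfl⟩ := Nat.exists_eq_add_of_le h.le
    exact (htail k).trans (hsum N (by simp))

theorem besselSeries_coeff_bounded {a : ℝ} (ha : ∀ n : ℤ, a ≠ n) :
    ∃ C, ∀ m : ℕ, |(Gamma (a + m + 1))⁻¹| ≤ C := by
  have hne : ∀ m : ℕ, a + m + 1 ≠ 0 := fun m h => ha (-(m + 1 : ℤ)) (by push_cast; linarith)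
  obtain ⟨N, hN⟩ := exists_nat_gt (-a)
  refine exists_bound_of_antitone_from (v := fun m : ℕ => |(Gamma (a + m + 1))⁻¹|) N fun m hm => ?_
  have hm' : (N : ℝ) ≤ m := by exact_mod_cast hm
  rw [show a + ((m + 1 : ℕ) : ℝ) + 1 = (a + m + 1) + 1 by push_cast; ring,
    Gamma_add_one (hne m), mul_inv, abs_mul]
  refine mul_le_of_le_one_left (abs_nonneg _) ?_
  rw [abs_inv, abs_of_pos (by linarith)]
  exact inv_le_one_of_one_le₀ (by linarith)

theorem ne_intCast_add_one {a : ℝ} (ha : ∀ n : ℤ, a ≠ n) (n : ℤ) : a + 1 ≠ n := fun h =>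
  ha (n - 1) (by push_cast; linarith)

theorem summable_besselSeries {a : ℝ} (ha : ∀ n : ℤ, a ≠ n) (y : ℝ) :
    Summable fun m : ℕ => y ^ m / ((m.factorial : ℝ) * Gamma (a + m + 1)) := by
  obtain ⟨C, hC⟩ := besselSeries_coeff_bounded ha
  refine Summable.of_norm_bounded ((Real.summable_pow_div_factorial |y|).mul_left C) fun m => ?_
  rw [div_mul_eq_div_div, div_eq_mul_inv _ (Gamma _), norm_mul, mul_comm]
  refine mul_le_mul (hC m) ?_ (norm_nonneg _) ((abs_nonneg _).trans (hC m))
  simp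

theorem hasDerivAt_besselSeries {a : ℝ} (ha : ∀ n : ℤ, a ≠ n) (y : ℝ) :
    HasDerivAt (besselSeries a) (besselSeries (a + 1) y) y := by
  obtain ⟨C, hC⟩ := besselSeries_coeff_bounded (ne_intCast_add_one ha)
  have hC0 : 0 ≤ C := (abs_nonneg _).trans (hC 0)
  set r := |y| + 1
  have hu : Summable fun m : ℕ => C * (m * r ^ (m - 1) / m.factorial) := by
    refine Summable.mul_left C ?_
    refine (summable_nat_add_iff 1).1 ((Real.summable_pow_div_factorial r).congr fun m => ?_)
    rw [Nat.factorial_succ]; push_cast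
    have : ((m : ℝ) + 1) ≠ 0 := by positivity
    field_simp
  have key := hasDerivAt_tsum_of_isPreconnected (t := Ioo (-r) r) (y := y) (y₀ := y)
    (g := fun (m : ℕ) (x : ℝ) => x ^ m / ((m.factorial : ℝ) * Gamma (a + m + 1)))
    (g' := fun (m : ℕ) (x : ℝ) => (m * x ^ (m - 1)) / ((m.factorial : ℝ) * Gamma (a + m + 1)))
    hu isOpen_Ioo isPreconnected_Ioo
    (fun m x _ => (hasDerivAt_pow m x).div_const _) (fun m x hx => ?_)
    (abs_lt.1 (by simp [r])) (summable_besselSeries ha y) (abs_lt.1 (by simp [r]))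
  · convert! key using 1
    rw [tsum_eq_zero_add', besselSeries]
    · simp only [Nat.cast_zero, zero_mul, zero_div, zero_add]
      refine tsum_congr fun m => ?_
      rw [Nat.factorial_succ]; push_cast
      have : ((m : ℝ) + 1) ≠ 0 := by positivity
      rw [show a + 1 + (m : ℝ) + 1 = a + (m + 1) + 1 by ring]
      rw [mul_assoc, mul_div_mul_left _ _ this]
    · refine (summable_besselSeries (ne_intCast_add_one ha) y).congr fun m => ?_
      rw [Nat.factorial_succ]; push_cast
      have : ((m : ℝ) + 1) ≠ 0 := by positivity
      rw [show a + 1 + (m : ℝ) + 1 = a + (m + 1) + 1 by ring]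
      rw [mul_assoc, mul_div_mul_left _ _ this]
  · rcases m with _ | m
    · simp
    · have hx' : |x| ≤ r := (abs_lt.2 hx).le
      rw [div_mul_eq_div_div, div_eq_mul_inv _ (Gamma _), norm_mul, mul_comm]
      gcongr
      · have := hC m
        rw [show a + 1 + (m : ℝ) + 1 = a + (m + 1 : ℕ) + 1 by push_cast; ring] at this
        exact this
      · simp only [norm_div, norm_mul, norm_pow, Real.norm_eq_abs, Nat.abs_cast]
        gcongr

theorem besselSeries_zero (a : ℝ) : besselSeries a 0 = (Gamma (a + 1))⁻¹ := by
  rw [besselSeries, tsum_eq_single 0 (fun m hm => by simp [hm])]; simp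

theorem besselI_two_mul {a s : ℝ} (hs : 0 < s) :
    besselI a (2 * s) = s ^ a * besselSeries a (s ^ 2) := by
  rw [besselI, besselSeries, ← tsum_mul_left]
  refine tsum_congr fun m => ?_
  rw [mul_div_cancel_left₀ s two_ne_zero, rpow_add hs, ← pow_mul,
    show (2 * (m : ℝ)) = ((2 * m : ℕ) : ℝ) by push_cast; ring, rpow_natCast, mul_div_assoc]

/-- The combination of Bessel series that represents the Macdonald integral for orders `a` that
are not integers, see `macdonaldIntegral_eq_macdonaldSeries`. -/
noncomputable def macdonaldSeries (a y : ℝ) : ℝ :=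
  π / sin (a * π) * (besselSeries (-a) y - y ^ a * besselSeries a y)

theorem sin_mul_pi_ne_zero {a : ℝ} (ha : ∀ n : ℤ, a ≠ n) : sin (a * π) ≠ 0 := fun h => by
  obtain ⟨n, hn⟩ := Real.sin_eq_zero_iff.1 h
  exact ha n (mul_right_cancel₀ pi_ne_zero hn.symm)

/-- Recurrence of the coefficients: `(y^a R_a)' = y^{a-1} R_{a-1}`. -/
theorem hasDerivAt_rpow_mul_besselSeries {a y : ℝ} (ha : ∀ n : ℤ, a ≠ n) (hy : 0 < y) :
    HasDerivAt (fun x => x ^ a * besselSeries a x) (y ^ (a - 1) * besselSeries (a - 1) y) y := by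
  have h := (Real.hasDerivAt_rpow_const (p := a) (Or.inl hy.ne')).mul (hasDerivAt_besselSeries ha y)
  refine h.congr_deriv ?_
  have ha1 : ∀ n : ℤ, a - 1 ≠ n := fun n h => ha (n + 1) (by push_cast; linarith)
  have hs1 := summable_besselSeries ha1 y
  have key : besselSeries (a - 1) y = a * besselSeries a y + y * besselSeries (a + 1) y := by
    have e1 : besselSeries (a + 1) y * y = ∑' m : ℕ, (m : ℝ) * (y ^ m / (m.factorial * Gamma (a + m + 1))) := by
      rw [tsum_eq_zero_add', besselSeries, ← tsum_mul_right]
      · simp only [Nat.cast_zero, zero_mul, zero_add]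
        refine tsum_congr fun m => ?_
        rw [Nat.factorial_succ]; push_cast
        have : ((m : ℝ) + 1) ≠ 0 := by positivity
        rw [show a + 1 + (m : ℝ) + 1 = a + (m + 1) + 1 by ring, pow_succ, mul_assoc ((m : ℝ) + 1),
          div_mul_eq_mul_div, mul_div_assoc', mul_div_mul_left _ _ this]
      · refine ((summable_besselSeries (ne_intCast_add_one ha) y).mul_left y).congr fun m => ?_
        rw [Nat.factorial_succ]; push_cast
        have : ((m : ℝ) + 1) ≠ 0 := by positivity
        rw [show a + 1 + (m : ℝ) + 1 = a + (m + 1) + 1 by ring, pow_succ, mul_assoc ((m : ℝ) + 1),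
          mul_div_assoc', mul_div_assoc', mul_div_mul_left _ _ this, mul_comm]
    have hs2 : Summable fun m : ℕ => (m : ℝ) * (y ^ m / (m.factorial * Gamma (a + m + 1))) := by
      refine (hs1.sub ((summable_besselSeries ha y).mul_left a)).congr fun m => ?_
      have hne : a + m ≠ 0 := fun h => ha (-m) (by push_cast; linarith)
      rw [show a - 1 + (m : ℝ) + 1 = a + m by ring, Gamma_add_one hne]
      have hG : Gamma (a + m) ≠ 0 := Gamma_ne_zero fun k hk =>
        ha (-(m + k : ℤ)) (by push_cast; linarith)
      field_simp; ring
    rw [mul_comm y, e1, besselSeries, besselSeries, ← tsum_mul_left,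
      ← ((summable_besselSeries ha y).mul_left a).tsum_add hs2]
    refine tsum_congr fun m => ?_
    have hne : a + m ≠ 0 := fun h => ha (-m) (by push_cast; linarith)
    rw [show a - 1 + (m : ℝ) + 1 = a + m by ring, Gamma_add_one hne]
    have hG : Gamma (a + m) ≠ 0 := Gamma_ne_zero fun k hk =>
      ha (-(m + k : ℤ)) (by push_cast; linarith)
    field_simp
  rw [key, rpow_sub_one hy.ne']
  field_simp

theorem hasDerivAt_macdonaldSeries {a y : ℝ} (ha : ∀ n : ℤ, a ≠ n) (hy : 0 < y) :
    HasDerivAt (macdonaldSeries a) (-macdonaldSeries (a - 1) y) y := by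
  have hna : ∀ n : ℤ, -a ≠ n := fun n h => ha (-n) (by push_cast; linarith)
  have h := ((hasDerivAt_besselSeries hna y).sub
    (hasDerivAt_rpow_mul_besselSeries ha hy)).const_mul (π / sin (a * π))
  refine h.congr_deriv ?_
  rw [macdonaldSeries, sub_mul, one_mul, Real.sin_sub_pi, neg_sub, div_neg]
  rw [show -a + 1 = 1 - a by ring]; ring

theorem macdonaldSeries_neg {y : ℝ} (hy : 0 < y) (a : ℝ) :
    macdonaldSeries (-a) y = y ^ (-a) * macdonaldSeries a y := by
  rw [macdonaldSeries, macdonaldSeries, neg_neg, neg_mul, Real.sin_neg, div_neg]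
  have : y ^ (-a) * y ^ a = 1 := by rw [← rpow_add hy]; simp
  linear_combination (π / sin (a * π) * besselSeries a y) * this

theorem tendsto_macdonaldSeries_zero {a : ℝ} (ha0 : 0 < a) (ha1 : a < 1) :
    Tendsto (macdonaldSeries a) (𝓝[>] 0) (𝓝 (Gamma a)) := by
  have ha : ∀ n : ℤ, a ≠ n := by
    rintro n rfl
    have h0 : 0 < n := by exact_mod_cast ha0
    have h1 : n < 1 := by exact_mod_cast ha1
    omega
  have hna : ∀ n : ℤ, -a ≠ n := fun n h => ha (-n) (by push_cast; linarith)
  have h1 : Tendsto (besselSeries (-a)) (𝓝[>] 0) (𝓝 (Gamma (-a + 1))⁻¹) := by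
    have := (hasDerivAt_besselSeries hna 0).continuousAt.tendsto
    rw [besselSeries_zero] at this
    exact this.mono_left nhdsWithin_le_nhds
  have h2 : Tendsto (fun y => y ^ a * besselSeries a y) (𝓝[>] 0) (𝓝 0) := by
    have e1 : ContinuousAt (fun y : ℝ => y ^ a) 0 :=
      Real.continuousAt_rpow_const 0 a (Or.inr ha0.le)
    have := (e1.mul (hasDerivAt_besselSeries ha 0).continuousAt).tendsto
    rw [Pi.mul_apply, Real.zero_rpow ha0.ne', zero_mul] at this
    exact this.mono_left nhdsWithin_le_nhds
  have h3 := (h1.sub h2).const_mul (π / sin (a * π))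
  have h4 := Real.Gamma_mul_Gamma_one_sub a
  have hG : Gamma (-a + 1) ≠ 0 := (Gamma_pos_of_pos (by linarith)).ne'
  convert! h3 using 2
  rw [mul_comm a, ← h4, sub_zero, show 1 - a = -a + 1 by ring, mul_inv_cancel_right₀ hG]

/-- Uniqueness for the first order system satisfied by `(H_a, H_{1-a})`: the squared norm of a
solution grows at most like `exp (y^a/a + y^{1-a}/(1-a))`, so a solution that tends to `0` at
the origin vanishes. -/
theorem eq_zero_of_macdonald_system {a : ℝ} (ha0 : 0 < a) (ha1 : a < 1) {f g : ℝ → ℝ}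
    (hf : ∀ y > 0, HasDerivAt f (-(y ^ (a - 1) * g y)) y)
    (hg : ∀ y > 0, HasDerivAt g (-(y ^ (-a) * f y)) y)
    (hf0 : Tendsto f (𝓝[>] 0) (𝓝 0)) (hg0 : Tendsto g (𝓝[>] 0) (𝓝 0)) {y : ℝ} (hy : 0 < y) :
    f y = 0 := by
  have hb : 0 < 1 - a := by linarith
  set Ω : ℝ → ℝ := fun y => y ^ a / a + y ^ (1 - a) / (1 - a) with hΩ
  set N : ℝ → ℝ := fun y => exp (-Ω y) * (f y ^ 2 + g y ^ 2) with hN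
  have hderiv : ∀ x > 0, HasDerivAt N
      (exp (-Ω x) * (-(x ^ (a - 1) + x ^ (-a))) * (f x ^ 2 + g x ^ 2) + exp (-Ω x) *
        (2 * f x * (-(x ^ (a - 1) * g x)) + 2 * g x * (-(x ^ (-a) * f x)))) x := by
    intro x hx
    have e1 : HasDerivAt Ω (x ^ (a - 1) + x ^ (-a)) x := by
      have d1 := (Real.hasDerivAt_rpow_const (p := a) (Or.inl hx.ne')).div_const a
      have d2 := (Real.hasDerivAt_rpow_const (p := 1 - a) (Or.inl hx.ne')).div_const (1 - a)
      refine (d1.add d2).congr_deriv ?_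
      rw [mul_div_cancel_left₀ _ ha0.ne', mul_div_cancel_left₀ _ hb.ne']
      congr 2; ring
    refine (e1.neg.exp.mul (((hf x hx).pow 2).add ((hg x hx).pow 2))).congr_deriv ?_
    simp
  have hanti : AntitoneOn N (Ioi 0) := by
    refine antitoneOn_of_hasDerivWithinAt_nonpos (convex_Ioi 0)
      (fun x hx => (hderiv x hx).continuousAt.continuousWithinAt)
      (fun x hx => (hderiv x (by simpa using hx)).hasDerivWithinAt) fun x hx => ?_
    have hx : 0 < x := by simpa using hx
    have p1 : 0 < x ^ (a - 1) + x ^ (-a) := by positivity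
    have : exp (-Ω x) * (-(x ^ (a - 1) + x ^ (-a))) * (f x ^ 2 + g x ^ 2) + exp (-Ω x) *
        (2 * f x * (-(x ^ (a - 1) * g x)) + 2 * g x * (-(x ^ (-a) * f x))) =
        -(exp (-Ω x) * (x ^ (a - 1) + x ^ (-a)) * (f x + g x) ^ 2) := by ring
    rw [this, neg_nonpos]
    positivity
  have hlim : Tendsto N (𝓝[>] 0) (𝓝 0) := by
    have hsq := (hf0.pow 2).add (hg0.pow 2)
    simp only [ne_eq, OfNat.ofNat_ne_zero, not_false_eq_true, zero_pow, add_zero] at hsq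
    refine squeeze_zero' ?_ ?_ hsq
    · filter_upwards with x; positivity
    · filter_upwards [self_mem_nhdsWithin] with x hx
      have hx : 0 < x := hx
      refine mul_le_of_le_one_left (by positivity) (Real.exp_le_one_iff.2 ?_)
      rw [neg_nonpos]; positivity
  have hle : N y ≤ 0 := by
    refine ge_of_tendsto hlim ?_
    filter_upwards [Ioo_mem_nhdsGT hy] with x hx
    exact hanti hx.1 hy hx.2.le
  have : f y ^ 2 + g y ^ 2 ≤ 0 := by
    by_contra h
    push Not at h
    have : 0 < N y := by positivity
    linarith
  nlinarith [sq_nonneg (f y), sq_nonneg (g y)]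

theorem macdonaldIntegral_eq_macdonaldSeries_of_mem_Ioo {a y : ℝ} (ha0 : 0 < a) (ha1 : a < 1)
    (hy : 0 < y) : macdonaldIntegral a y = macdonaldSeries a y := by
  have hni : ∀ a : ℝ, 0 < a → a < 1 → ∀ n : ℤ, a ≠ n := by
    rintro a ha0 ha1 n rfl
    have h0 : 0 < n := by exact_mod_cast ha0
    have h1 : n < 1 := by exact_mod_cast ha1
    omega
  have hstep : ∀ a : ℝ, 0 < a → a < 1 → ∀ y > 0,
      HasDerivAt (fun y => macdonaldIntegral a y - macdonaldSeries a y)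
        (-(y ^ (a - 1) * (macdonaldIntegral (1 - a) y - macdonaldSeries (1 - a) y))) y := by
    intro a ha0 ha1 y hy
    refine ((hasDerivAt_macdonaldIntegral hy a).sub
      (hasDerivAt_macdonaldSeries (hni a ha0 ha1) hy)).congr_deriv ?_
    rw [show a - 1 = -(1 - a) by ring, macdonaldIntegral_neg hy, macdonaldSeries_neg hy]
    ring
  have hlim : ∀ a : ℝ, 0 < a → a < 1 →
      Tendsto (fun y => macdonaldIntegral a y - macdonaldSeries a y) (𝓝[>] 0) (𝓝 0) := by
    intro a ha0 ha1
    simpa using (tendsto_macdonaldIntegral_zero ha0).sub (tendsto_macdonaldSeries_zero ha0 ha1)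
  refine sub_eq_zero.1 (eq_zero_of_macdonald_system ha0 ha1 (hstep a ha0 ha1) (fun y hy => ?_)
    (hlim a ha0 ha1) (hlim (1 - a) (by linarith) (by linarith)) hy)
  have := hstep (1 - a) (by linarith) (by linarith) y hy
  simpa using this

/-- Differentiation lowers the order by one on both sides, starting from orders in `(0, 1)`. -/
theorem macdonaldIntegral_eq_macdonaldSeries {a y : ℝ} (ha1 : a < 1) (ha : ∀ n : ℤ, a ≠ n)
    (hy : 0 < y) : macdonaldIntegral a y = macdonaldSeries a y := by
  have key : ∀ (n : ℕ) (b : ℝ), 0 < b → b < 1 → ∀ y > 0,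
      macdonaldIntegral (b - n) y = macdonaldSeries (b - n) y := by
    intro n b hb0 hb1
    induction n with
    | zero =>
      intro y hy
      simpa using macdonaldIntegral_eq_macdonaldSeries_of_mem_Ioo hb0 hb1 hy
    | succ n ih =>
      intro y hy
      have hb : ∀ k : ℤ, b - n ≠ k := by
        intro k hk
        have h0 : (0 : ℝ) < ((k + n : ℤ) : ℝ) := by push_cast; linarith
        have h1 : ((k + n : ℤ) : ℝ) < (1 : ℤ) := by push_cast; linarith
        rw [Int.cast_lt] at h1
        rw [Int.cast_pos] at h0
        omega
      have h1 := hasDerivAt_macdonaldIntegral hy (b - n)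
      have h2 := hasDerivAt_macdonaldSeries hb hy
      have h3 : macdonaldIntegral (b - n) =ᶠ[𝓝 y] macdonaldSeries (b - n) := by
        filter_upwards [lt_mem_nhds hy] with x hx using ih x hx
      have h4 := h1.unique (h2.congr_of_eventuallyEq h3)
      push_cast
      rw [← sub_sub]
      linarith
  obtain ⟨n, hn⟩ : ∃ n : ℕ, (⌊a⌋ : ℤ) = -(n : ℤ) := by
    have : ⌊a⌋ < 1 := Int.floor_lt.2 (by exact_mod_cast ha1)
    exact ⟨(-⌊a⌋).toNat, by omega⟩
  have h0 : 0 < Int.fract a :=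
    lt_of_le_of_ne (Int.fract_nonneg a) fun h => ha ⌊a⌋ (by
      rw [Int.fract] at h; linarith)
  have := key n (Int.fract a) h0 (Int.fract_lt_one a) y hy
  have e : Int.fract a - n = a := by
    have : ((⌊a⌋ : ℤ) : ℝ) = -n := by rw [hn]; push_cast; ring
    rw [Int.fract, this]; ring
  rwa [e] at this

/-- The integral representation of `K_ν`, for the orders `ν > -1` that occur here. Near `ν` the orders
different from `ν` are not integers, and the integral is continuous in the order. -/
theorem besselK_two_mul {ν s : ℝ} (hν : -1 < ν) (hs : 0 < s) :
    besselK ν (2 * s) = 2⁻¹ * (s ^ (-ν) * macdonaldIntegral ν (s ^ 2)) := by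
  have hs2 : 0 < s ^ 2 := by positivity
  have hpow : ∀ a : ℝ, (s ^ 2) ^ a = s ^ a * s ^ a := fun a => by
    rw [← rpow_natCast, ← rpow_mul hs.le, ← rpow_add hs]; congr 1; push_cast; ring
  have hfun : (fun a : ℝ => π / 2 * ((besselI (-a) (2 * s) - besselI a (2 * s)) / sin (a * π)))
      =ᶠ[𝓝[≠] ν] fun a => 2⁻¹ * (s ^ a * macdonaldIntegral (-a) (s ^ 2)) := by
    have h1 : ∀ᶠ a in 𝓝[≠] ν, -1 < a := (lt_mem_nhds hν).filter_mono nhdsWithin_le_nhds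
    have h2 : ∀ᶠ a : ℝ in 𝓝[≠] ν, ∀ n : ℤ, a ≠ n := by
      have hc : IsClosed ((fun n : ℤ => (n : ℝ)) '' {n : ℤ | (n : ℝ) ≠ ν}) :=
        Int.isClosedEmbedding_coe_real.isClosedMap _ (isClosed_discrete _)
      have hm : ((fun n : ℤ => (n : ℝ)) '' {n : ℤ | (n : ℝ) ≠ ν})ᶜ ∈ 𝓝 ν :=
        hc.isOpen_compl.mem_nhds (by simp)
      filter_upwards [nhdsWithin_le_nhds hm, self_mem_nhdsWithin] with a ha hne n hn
      exact ha ⟨n, fun h => hne (hn.trans h), hn.symm⟩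
    filter_upwards [h1, h2] with a ha hni
    have hni' : ∀ n : ℤ, -a ≠ n := fun n h => hni (-n) (by push_cast; linarith)
    rw [macdonaldIntegral_eq_macdonaldSeries (by linarith) hni' hs2, macdonaldSeries_neg hs2,
      macdonaldSeries, besselI_two_mul hs, besselI_two_mul hs, rpow_neg hs2.le, hpow,
      rpow_neg hs.le]
    have := sin_mul_pi_ne_zero hni
    have : 0 < s ^ a := by positivity
    field_simp
  have hc : Continuous fun a => 2⁻¹ * (s ^ a * macdonaldIntegral (-a) (s ^ 2)) :=
    continuous_const.mul ((Real.continuous_const_rpow hs.ne').mul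
      ((continuous_macdonaldIntegral_left hs2).comp continuous_neg))
  have hlim := ((hc.tendsto ν).mono_left nhdsWithin_le_nhds).congr' hfun.symm
  rw [besselK, hlim.limUnder_eq, macdonaldIntegral_neg hs2, rpow_neg hs2.le, hpow, rpow_neg hs.le]
  have : 0 < s ^ ν := by positivity
  field_simp

/-! ### Polar coordinates and the Fourier transform of the sphere -/

section Polar

variable {F : Type*} [NormedAddCommGroup F]

theorem integrable_volumeIoiPow_iff {k : ℕ} [NormedSpace ℝ F] {h : ℝ → F} :
    Integrable (fun s : Ioi (0 : ℝ) => h s) (Measure.volumeIoiPow k) ↔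
      IntegrableOn (fun s => s ^ k • h s) (Ioi 0) := by
  rw [Measure.volumeIoiPow, integrable_withDensity_iff_integrable_smul' (by fun_prop) (by simp),
    integrableOn_iff_comap_subtypeVal measurableSet_Ioi]
  refine integrable_congr (Eventually.of_forall fun s => ?_)
  have hs : 0 < (s : ℝ) := s.2
  simp only [Function.comp_apply]
  rw [ENNReal.toReal_ofReal (by positivity)]

theorem integral_volumeIoiPow [NormedSpace ℝ F] (k : ℕ) (h : ℝ → F) :
    ∫ s : Ioi (0 : ℝ), h s ∂(Measure.volumeIoiPow k) = ∫ s in Ioi (0 : ℝ), s ^ k • h s := by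
  rw [Measure.volumeIoiPow, integral_withDensity_eq_integral_toReal_smul (by fun_prop) (by simp),
    ← integral_subtype_comap measurableSet_Ioi fun s : ℝ => s ^ k • h s]
  refine integral_congr_ae (Eventually.of_forall fun s => ?_)
  have hs : 0 < (s : ℝ) := s.2
  simp only
  rw [ENNReal.toReal_ofReal (by positivity)]

variable {E : Type*} [NormedAddCommGroup E] [InnerProductSpace ℝ E] [FiniteDimensional ℝ E]
  [MeasurableSpace E] [BorelSpace E]

theorem integrable_polar {f : E → F} (hf : Integrable f) :
    Integrable (fun u : Metric.sphere (0 : E) 1 × Ioi (0 : ℝ) => f (u.2.1 • u.1.1))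
      ((volume : Measure E).toSphere.prod (Measure.volumeIoiPow (Module.finrank ℝ E - 1))) := by
  have h := (volume : Measure E).measurePreserving_homeomorphUnitSphereProd
  have hemb := (homeomorphUnitSphereProd E).measurableEmbedding
  rw [← h.integrable_comp_emb hemb]
  have h2 : IntegrableOn f ({0}ᶜ : Set E) := hf.integrableOn
  rw [integrableOn_iff_comap_subtypeVal (measurableSet_singleton _).compl] at h2
  refine h2.congr (Eventually.of_forall fun x => ?_)
  have hx : ‖(x : E)‖ ≠ 0 := norm_ne_zero_iff.2 x.2
  simp [smul_smul, hx]

theorem integral_polar_prod [NormedSpace ℝ F] [Nontrivial E] (f : E → F) :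
    ∫ x, f x = ∫ u : Metric.sphere (0 : E) 1 × Ioi (0 : ℝ), f (u.2.1 • u.1.1)
      ∂((volume : Measure E).toSphere.prod (Measure.volumeIoiPow (Module.finrank ℝ E - 1))) := by
  have h := (volume : Measure E).measurePreserving_homeomorphUnitSphereProd
  have hemb := (homeomorphUnitSphereProd E).measurableEmbedding
  have h0 : ∫ x, f x = ∫ x : ({0}ᶜ : Set E), f x ∂((volume : Measure E).comap (↑)) := by
    rw [integral_subtype_comap (measurableSet_singleton _).compl f, restrict_compl_singleton]
  rw [← h.integral_comp hemb, h0]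
  refine integral_congr_ae (Eventually.of_forall fun x => ?_)
  have hx : ‖(x : E)‖ ≠ 0 := norm_ne_zero_iff.2 x.2
  simp [smul_smul, hx]

theorem integral_polar [NormedSpace ℝ F] [CompleteSpace F] [Nontrivial E] {f : E → F} (hf : Integrable f) :
    ∫ x, f x = ∫ s in Ioi (0 : ℝ), s ^ (Module.finrank ℝ E - 1) •
      ∫ ω : Metric.sphere (0 : E) 1, f (s • ω.1) ∂(volume : Measure E).toSphere := by
  rw [integral_polar_prod, integral_prod_symm _ (integrable_polar hf)]
  exact integral_volumeIoiPow (Module.finrank ℝ E - 1)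
    (fun s => ∫ ω : Metric.sphere (0 : E) 1, f (s • ω.1) ∂(volume : Measure E).toSphere)

/-- The Fourier transform of the surface measure of the unit sphere. -/
noncomputable def sphereFourier (x : E) : ℂ :=
  ∫ ω : Metric.sphere (0 : E) 1, Complex.exp (Complex.I * (inner ℝ ω.1 x : ℝ))
    ∂(volume : Measure E).toSphere

theorem continuous_sphereFourier : Continuous (sphereFourier : E → ℂ) := by
  refine continuous_of_dominated (bound := fun _ => 1) (fun x => ?_) (fun x => ?_)
    (integrable_const _) ?_
  · exact Continuous.aestronglyMeasurable (by fun_prop)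
  · exact Eventually.of_forall fun ω => by
      rw [mul_comm, Complex.norm_exp_ofReal_mul_I]
  · exact Eventually.of_forall fun ω => by fun_prop

theorem norm_sphereFourier_le (x : E) :
    ‖sphereFourier x‖ ≤ (volume : Measure E).toSphere.real univ := by
  have := norm_integral_le_of_norm_le_const (μ := (volume : Measure E).toSphere) (C := 1)
    (f := fun ω => Complex.exp (Complex.I * (inner ℝ ω.1 x : ℝ)))
    (Eventually.of_forall fun ω => by rw [mul_comm, Complex.norm_exp_ofReal_mul_I])
  rwa [one_mul] at this

/-- The Fourier transform of a Gaussian in polar coordinates. -/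
theorem integral_exp_mul_sphereFourier [Nontrivial E] {t : ℝ} (ht : 0 < t) (x : E) :
    ∫ s in Ioi (0 : ℝ), ((s ^ (Module.finrank ℝ E - 1) * exp (-s ^ 2 / t) : ℝ) : ℂ) *
      sphereFourier (s • x) =
    (((π * t) ^ ((Module.finrank ℝ E : ℝ) / 2) * exp (-t * ‖x‖ ^ 2 / 4) : ℝ) : ℂ) := by
  have hb : 0 < ((t⁻¹ : ℝ) : ℂ).re := by simpa using ht
  have hint := GaussianFourier.integrable_cexp_neg_mul_sq_norm_add hb Complex.I x
  have h := GaussianFourier.integral_cexp_neg_mul_sq_norm_add hb Complex.I x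
  rw [integral_polar hint] at h
  refine Eq.trans ?_ (h.trans ?_)
  · refine setIntegral_congr_fun measurableSet_Ioi fun s hs => ?_
    have hs : 0 < s := hs
    simp only [sphereFourier]
    rw [Complex.ofReal_mul, mul_assoc, ← integral_const_mul, Complex.real_smul]
    congr 1
    refine integral_congr_ae (Eventually.of_forall fun ω => ?_)
    have hω : ‖ω.1‖ = 1 := by simp
    simp only [norm_smul, hω, mul_one, Real.norm_eq_abs, abs_of_pos hs, inner_smul_right]
    rw [real_inner_comm, Complex.ofReal_exp, ← Complex.exp_add]
    congr 1
    push_cast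
    ring
  · push_cast
    rw [Complex.ofReal_cpow (by positivity)]
    congr 1
    · push_cast
      rw [div_inv_eq_mul]
    · congr 1
      rw [Complex.I_sq]
      field_simp

/-! ### Moments of the sphere -/

/-- The moments of a linear form under the Gaussian weight `e^{-‖v‖²}`. The generating function
`m₀(t) = π^{d/2} e^{‖x‖²t²/4}` satisfies `m₀' = (‖x‖²/2) t m₀`; the recursion is the Leibniz rule
at `t = 0`. -/
theorem gaussian_moment_recursion (x : E) :
    (∀ n : ℕ, Integrable fun v : E => exp (-‖v‖ ^ 2) * (inner ℝ x v) ^ n) ∧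
    (∫ v : E, exp (-‖v‖ ^ 2) * (inner ℝ x v) ^ 1 = 0) ∧
    ∀ n : ℕ, ∫ v : E, exp (-‖v‖ ^ 2) * (inner ℝ x v) ^ (n + 2) =
      ‖x‖ ^ 2 / 2 * (n + 1) * ∫ v : E, exp (-‖v‖ ^ 2) * (inner ℝ x v) ^ n := by
  set ν : Measure E := volume.withDensity fun v => ENNReal.ofReal (exp (-‖v‖ ^ 2)) with hν
  set X : E → ℝ := fun v => inner ℝ x v with hX
  have hwd : ∀ h : E → ℝ, ∫ v, h v ∂ν = ∫ v, exp (-‖v‖ ^ 2) * h v := fun h => by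
    rw [hν, integral_withDensity_eq_integral_toReal_smul (by fun_prop) (by simp)]
    simp [ENNReal.toReal_ofReal (exp_pos _).le]
  have hwi : ∀ h : E → ℝ, Integrable h ν ↔ Integrable fun v => exp (-‖v‖ ^ 2) * h v := fun h => by
    rw [hν, integrable_withDensity_iff_integrable_smul' (by fun_prop) (by simp)]
    simp [ENNReal.toReal_ofReal (exp_pos _).le]
  have hre : ∀ (t : ℝ) (v : E), exp (-‖v‖ ^ 2) * exp (t * X v) =
      (Complex.exp (-((1 : ℝ) : ℂ) * ‖v‖ ^ 2 + (t : ℂ) * (inner ℝ x v : ℝ))).re := fun t v => by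
    rw [← Real.exp_add, ← Complex.ofReal_re (exp _), Complex.ofReal_exp]
    congr 2; simp [hX]
  have hb : 0 < ((1 : ℝ) : ℂ).re := by simp
  have hexpint : ∀ t : ℝ, Integrable (fun v => exp (t * X v)) ν := fun t => by
    rw [hwi]
    simp_rw [hre]
    exact (GaussianFourier.integrable_cexp_neg_mul_sq_norm_add hb (t : ℂ) x).re
  have hset : ProbabilityTheory.integrableExpSet X ν = univ := by
    ext t; simpa [ProbabilityTheory.integrableExpSet] using hexpint t
  have hint : ∀ t : ℝ, t ∈ interior (ProbabilityTheory.integrableExpSet X ν) := by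
    simp [hset]
  set m : ℕ → ℝ → ℝ := fun n t => ∫ v, X v ^ n * exp (t * X v) ∂ν with hm
  have hd : ∀ n t, HasDerivAt (m n) (m (n + 1) t) t := fun n t =>
    ProbabilityTheory.hasDerivAt_integral_pow_mul_exp_real (hint t) n
  have hm0 : ∀ t, m 0 t = π ^ ((Module.finrank ℝ E : ℝ) / 2) * exp (‖x‖ ^ 2 / 4 * t ^ 2) := by
    intro t
    have h := GaussianFourier.integral_cexp_neg_mul_sq_norm_add hb (t : ℂ) x
    simp only [hm, pow_zero, one_mul]
    rw [hwd]
    simp_rw [hre]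
    have hre2 := integral_re (𝕜 := ℂ)
      (GaussianFourier.integrable_cexp_neg_mul_sq_norm_add hb (t : ℂ) x)
    simp only [RCLike.re_to_complex] at hre2
    rw [hre2, h, ← Complex.ofReal_re (π ^ _ * _)]
    congr 1
    push_cast
    rw [Complex.ofReal_cpow pi_pos.le]
    push_cast
    rw [div_one]
    congr 2
    ring
  have hm1 : ∀ t, m 1 t = ‖x‖ ^ 2 / 2 * t * m 0 t := by
    intro t
    have h1 : HasDerivAt (m 0) (‖x‖ ^ 2 / 2 * t * m 0 t) t := by
      rw [show m 0 = _ from funext hm0]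
      have := (((hasDerivAt_pow 2 t).const_mul (‖x‖ ^ 2 / 4)).exp).const_mul
        (π ^ ((Module.finrank ℝ E : ℝ) / 2))
      refine this.congr_deriv ?_
      simp; ring
    exact (hd 0 t).unique h1
  have hrec : ∀ (n : ℕ) t, m (n + 2) t =
      ‖x‖ ^ 2 / 2 * t * m (n + 1) t + ‖x‖ ^ 2 / 2 * (n + 1) * m n t := by
    intro n
    induction n with
    | zero =>
      intro t
      have h1 : HasDerivAt (m 1) (‖x‖ ^ 2 / 2 * t * m 1 t + ‖x‖ ^ 2 / 2 * (0 + 1) * m 0 t) t := by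
        rw [show m 1 = _ from funext hm1]
        have := (((hasDerivAt_id t).const_mul (‖x‖ ^ 2 / 2)).mul (hd 0 t))
        refine this.congr_deriv ?_
        simp only [id, hm1, zero_add]
        ring
      simpa using (hd 1 t).unique h1
    | succ n ih =>
      intro t
      have h1 : HasDerivAt (m (n + 2)) (‖x‖ ^ 2 / 2 * t * m (n + 2) t +
          ‖x‖ ^ 2 / 2 * ((n + 1 : ℕ) + 1) * m (n + 1) t) t := by
        rw [show m (n + 2) = _ from funext ih]
        have := (((hasDerivAt_id t).const_mul (‖x‖ ^ 2 / 2)).mul (hd (n + 1) t)).add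
          ((hd n t).const_mul (‖x‖ ^ 2 / 2 * (n + 1)))
        refine this.congr_deriv ?_
        simp only [id]
        rw [ih t]
        push_cast; ring
      exact (hd (n + 2) t).unique h1
  have hmz : ∀ n, ∫ v : E, exp (-‖v‖ ^ 2) * (inner ℝ x v) ^ n = m n 0 := fun n => by
    simp [hm, hwd, hX]
  refine ⟨fun n => ?_, ?_, fun n => ?_⟩
  · have := ProbabilityTheory.integrable_pow_of_mem_interior_integrableExpSet (hint 0) n
    rwa [hwi] at this
  · rw [hmz, hm1]; simp
  · rw [hmz, hmz, hrec]; simp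

/-- The moments `∫_S ⟨x, ω⟩^n dω` of a linear form on the unit sphere. -/
noncomputable def sphereMoment (x : E) (n : ℕ) : ℝ :=
  ∫ ω : Metric.sphere (0 : E) 1, (inner ℝ x ω.1) ^ n ∂(volume : Measure E).toSphere

/-- In polar coordinates a Gaussian moment is a moment of the sphere times a Gamma factor. -/
theorem integral_gaussian_pow_eq_sphereMoment [Nontrivial E] (x : E) (n : ℕ) :
    ∫ v : E, exp (-‖v‖ ^ 2) * (inner ℝ x v) ^ n =
      Gamma (((Module.finrank ℝ E : ℝ) + n) / 2) / 2 * sphereMoment x n := by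
  have hd : 1 ≤ Module.finrank ℝ E := Module.finrank_pos
  rw [integral_polar ((gaussian_moment_recursion x).1 n)]
  have h := integral_rpow_mul_exp_neg_rpow (p := 2) (q := (Module.finrank ℝ E : ℝ) + n - 1)
    two_pos (by have : (1 : ℝ) ≤ Module.finrank ℝ E := by exact_mod_cast hd
                have : (0 : ℝ) ≤ n := by positivity
                linarith)
  rw [sub_add_cancel] at h
  rw [div_eq_mul_one_div, mul_comm (Gamma _), ← h, ← integral_mul_const]
  refine setIntegral_congr_fun measurableSet_Ioi fun s hs => ?_
  have hs : 0 < s := hs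
  have e1 : s ^ ((Module.finrank ℝ E : ℝ) + n - 1) = s ^ (Module.finrank ℝ E - 1) * s ^ n := by
    rw [← rpow_natCast, ← rpow_natCast, ← rpow_add hs]
    congr 1; rw [Nat.cast_sub hd]; push_cast; ring
  simp only [sphereMoment, smul_eq_mul]
  rw [e1, ← integral_const_mul, ← integral_const_mul]
  refine integral_congr_ae (Eventually.of_forall fun ω => ?_)
  have hω : ‖ω.1‖ = 1 := by simp
  simp only [norm_smul, hω, mul_one, Real.norm_eq_abs, abs_of_pos hs, inner_smul_right, mul_pow]
  rw [← rpow_natCast s 2]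
  push_cast; ring

theorem sphereMoment_odd [Nontrivial E] (x : E) (k : ℕ) : sphereMoment x (2 * k + 1) = 0 := by
  obtain ⟨-, h1, h2⟩ := gaussian_moment_recursion x
  have h : ∀ k : ℕ, ∫ v : E, exp (-‖v‖ ^ 2) * (inner ℝ x v) ^ (2 * k + 1) = 0 := by
    intro k
    induction k with
    | zero => simpa using h1
    | succ k ih => rw [show 2 * (k + 1) + 1 = (2 * k + 1) + 2 by ring, h2, ih, mul_zero]
  have := h k
  rw [integral_gaussian_pow_eq_sphereMoment] at this
  refine (mul_eq_zero.1 this).resolve_left (div_ne_zero (Gamma_pos_of_pos ?_).ne' two_ne_zero)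
  positivity

theorem sphereMoment_zero [Nontrivial E] (x : E) :
    sphereMoment x 0 = 2 * π ^ ((Module.finrank ℝ E : ℝ) / 2) / Gamma ((Module.finrank ℝ E : ℝ) / 2) := by
  have hd : (0 : ℝ) < Module.finrank ℝ E := by exact_mod_cast Module.finrank_pos
  have h := integral_gaussian_pow_eq_sphereMoment x 0
  have h2 := GaussianFourier.integral_rexp_neg_mul_sq_norm (V := E) one_pos
  simp only [pow_zero, mul_one, Nat.cast_zero, add_zero] at h
  simp only [neg_mul, one_mul, div_one] at h2
  rw [h2] at h
  have hG : 0 < Gamma ((Module.finrank ℝ E : ℝ) / 2) := Gamma_pos_of_pos (by positivity)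
  rw [h]; field_simp

theorem sphereMoment_even_succ [Nontrivial E] (x : E) (k : ℕ) :
    ((Module.finrank ℝ E : ℝ) / 2 + k) * sphereMoment x (2 * (k + 1)) =
      ‖x‖ ^ 2 / 2 * (2 * k + 1) * sphereMoment x (2 * k) := by
  have hd : (0 : ℝ) < Module.finrank ℝ E := by exact_mod_cast Module.finrank_pos
  have h := (gaussian_moment_recursion x).2.2 (2 * k)
  rw [integral_gaussian_pow_eq_sphereMoment, integral_gaussian_pow_eq_sphereMoment] at h
  have e : ((Module.finrank ℝ E : ℝ) + (2 * k + 2 : ℕ)) / 2 =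
      ((Module.finrank ℝ E : ℝ) + (2 * k : ℕ)) / 2 + 1 := by push_cast; ring
  have hpos : (0 : ℝ) < ((Module.finrank ℝ E : ℝ) + (2 * k : ℕ)) / 2 := by positivity
  rw [e, Gamma_add_one hpos.ne'] at h
  have hG := (Gamma_pos_of_pos hpos)
  rw [show 2 * (k + 1) = 2 * k + 2 by ring]
  rw [← mul_right_inj' hG.ne']
  push_cast at h ⊢
  linear_combination 2 * h

/-- The function `₀F₁(; c; -v) = ∑ (-v)^k / (k! (c)_k)`, that is, `Γ(c) v^{(1-c)/2} J_{c-1}(2√v)`. -/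
noncomputable def normalizedBesselJ (c v : ℝ) : ℝ :=
  ∑' k : ℕ, (-v) ^ k / ((k.factorial : ℝ) * (ascPochhammer ℝ k).eval c)

/-- The Fourier transform of the sphere is a Bessel function: expand the exponential and insert the
moments. -/
theorem sphereFourier_eq [Nontrivial E] (x : E) :
    sphereFourier x = ((2 * π ^ ((Module.finrank ℝ E : ℝ) / 2) / Gamma ((Module.finrank ℝ E : ℝ) / 2) *
      normalizedBesselJ ((Module.finrank ℝ E : ℝ) / 2) (‖x‖ ^ 2 / 4) : ℝ) : ℂ) := by
  have hd : (0 : ℝ) < Module.finrank ℝ E := by exact_mod_cast Module.finrank_pos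
  set σ := (volume : Measure E).toSphere
  have hsum : HasSum (fun n : ℕ => ∫ ω : Metric.sphere (0 : E) 1,
      (Complex.I ^ n / n.factorial) * ((inner ℝ x ω.1 : ℝ) : ℂ) ^ n ∂σ) (sphereFourier x) := by
    refine hasSum_integral_of_dominated_convergence
      (bound := fun n _ => ‖x‖ ^ n / n.factorial) (fun n => ?_) (fun n => ?_) ?_ ?_ ?_
    · exact Continuous.aestronglyMeasurable (by fun_prop)
    · refine Eventually.of_forall fun ω => ?_
      have hω : ‖ω.1‖ = 1 := by simp
      have h1 : |inner ℝ x ω.1| ≤ ‖x‖ := by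
        simpa [hω] using abs_real_inner_le_norm x ω.1
      simp only [norm_mul, norm_div, norm_pow, Complex.norm_I, one_pow, Complex.norm_natCast,
        Complex.norm_real, Real.norm_eq_abs]
      rw [one_div_mul_eq_div]
      gcongr
    · exact Eventually.of_forall fun _ => Real.summable_pow_div_factorial _
    · exact integrable_const _
    · refine Eventually.of_forall fun ω => ?_
      have := NormedSpace.expSeries_div_hasSum_exp (𝔸 := ℂ) (Complex.I * (inner ℝ ω.1 x : ℝ))
      rw [← Complex.exp_eq_exp_ℂ] at this
      convert! this using 2 with n
      rw [real_inner_comm, mul_pow]; ring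
  have hterm : ∀ n : ℕ, ∫ ω : Metric.sphere (0 : E) 1,
      (Complex.I ^ n / n.factorial) * ((inner ℝ x ω.1 : ℝ) : ℂ) ^ n ∂σ =
      Complex.I ^ n / n.factorial * (sphereMoment x n : ℝ) := fun n => by
    rw [integral_const_mul, sphereMoment, ← integral_complex_ofReal]
    push_cast; rfl
  simp_rw [hterm] at hsum
  have hinj : Function.Injective fun k : ℕ => 2 * k := fun a b h => by simpa using h
  rw [← hinj.hasSum_iff] at hsum
  · have hcoef : ∀ k : ℕ, (-1) ^ k / ((2 * k).factorial : ℝ) * sphereMoment x (2 * k) =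
        (2 * π ^ ((Module.finrank ℝ E : ℝ) / 2) / Gamma ((Module.finrank ℝ E : ℝ) / 2)) *
        ((-(‖x‖ ^ 2 / 4)) ^ k / ((k.factorial : ℝ) *
          (ascPochhammer ℝ k).eval ((Module.finrank ℝ E : ℝ) / 2))) := by
      intro k
      induction k with
      | zero => simp [sphereMoment_zero]
      | succ k ih =>
        have h1 := sphereMoment_even_succ x k
        have hp : (0 : ℝ) < (Module.finrank ℝ E : ℝ) / 2 + k := by positivity
        have hpk := ascPochhammer_pos k ((Module.finrank ℝ E : ℝ) / 2) (by positivity)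
        have h2 : sphereMoment x (2 * (k + 1)) =
            ‖x‖ ^ 2 / 2 * (2 * k + 1) * sphereMoment x (2 * k) / ((Module.finrank ℝ E : ℝ) / 2 + k) := by
          rw [eq_div_iff hp.ne', mul_comm, h1]
        rw [h2, ascPochhammer_succ_eval, show 2 * (k + 1) = 2 * k + 1 + 1 by ring,
          Nat.factorial_succ, Nat.factorial_succ, Nat.factorial_succ]
        have h3 : (-1) ^ (k + 1) / (((2 * k + 1 + 1) * ((2 * k + 1) * (2 * k).factorial) : ℕ) : ℝ) *
          (‖x‖ ^ 2 / 2 * (2 * k + 1) * sphereMoment x (2 * k) / ((Module.finrank ℝ E : ℝ) / 2 + k)) =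
          ((-1) ^ k / ((2 * k).factorial : ℝ) * sphereMoment x (2 * k)) *
            (-(‖x‖ ^ 2 / 4) / ((k + 1) * ((Module.finrank ℝ E : ℝ) / 2 + k))) := by
          push_cast
          field_simp
          ring
        rw [h3, ih]
        rw [pow_succ (-(‖x‖ ^ 2 / 4)) k]
        push_cast
        field_simp
    have hreal : (fun n : ℕ => Complex.I ^ n / n.factorial * (sphereMoment x n : ℝ)) ∘
        (fun k : ℕ => 2 * k) = fun k : ℕ => (((2 * π ^ ((Module.finrank ℝ E : ℝ) / 2) /
          Gamma ((Module.finrank ℝ E : ℝ) / 2)) * ((-(‖x‖ ^ 2 / 4)) ^ k / ((k.factorial : ℝ) *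
          (ascPochhammer ℝ k).eval ((Module.finrank ℝ E : ℝ) / 2))) : ℝ) : ℂ) := by
      funext k
      rw [← hcoef]
      simp only [Function.comp_apply]
      rw [pow_mul, Complex.I_sq]
      push_cast; rfl
    rw [hreal] at hsum
    rw [← hsum.tsum_eq, ← Complex.ofReal_tsum, tsum_mul_left]; rfl
  · intro n hn
    rcases Nat.even_or_odd' n with ⟨k, rfl | rfl⟩
    · exact absurd ⟨k, rfl⟩ hn
    · simp [sphereMoment_odd]

end Polar

/-! ### A product formula for Bessel functions -/

/-- The coefficients `(-1)^k binom(m,k) / (c)_k` of the normalized Laguerre polynomial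
`L_m^{(c-1)}(t) / L_m^{(c-1)}(0)`. -/
noncomputable def laguerreCoeff (c : ℝ) (m k : ℕ) : ℝ :=
  (-1) ^ k * (m.choose k : ℝ) / (ascPochhammer ℝ k).eval c

theorem laguerreCoeff_succ_succ {c : ℝ} (hc : 0 < c) (m k : ℕ) :
    (c + m) * laguerreCoeff c (m + 1) (k + 1) =
      (c + m + (k + 1)) * laguerreCoeff c m (k + 1) - laguerreCoeff c m k := by
  have h1 := (ascPochhammer_pos k c hc).ne'
  have h2 : c + (k : ℝ) ≠ 0 := by positivity
  have h3 : ((m.choose (k + 1) : ℕ) : ℝ) * (k + 1) = m.choose k * ((m : ℝ) - k) := by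
    rcases le_or_gt k m with h | h
    · have := Nat.choose_succ_right_eq m k
      rw [← Nat.cast_sub h]; exact_mod_cast this
    · rw [Nat.choose_eq_zero_of_lt h, Nat.choose_eq_zero_of_lt (by omega)]; simp
  rw [laguerreCoeff, laguerreCoeff, laguerreCoeff, ascPochhammer_succ_eval, Nat.choose_succ_succ]
  push_cast
  field_simp
  rw [pow_succ]
  linear_combination (-1) ^ k * h3

/-- The recurrence of the Laguerre polynomials in the degree, applied to a linear functional with
moments `h k`. -/
theorem mul_sum_laguerreCoeff_succ {c : ℝ} (hc : 0 < c) (m : ℕ) (h : ℕ → ℝ) :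
    (c + m) * ∑ k ∈ Finset.range (m + 1 + 1), laguerreCoeff c (m + 1) k * h k =
      ∑ k ∈ Finset.range (m + 1), laguerreCoeff c m k * ((c + m + k) * h k - h (k + 1)) := by
  have e3 : laguerreCoeff c m (m + 1) = 0 := by simp [laguerreCoeff]
  have e4 : ∀ k, laguerreCoeff c k 0 = 1 := fun k => by simp [laguerreCoeff]
  have e5 : ∑ k ∈ Finset.range (m + 1), (c + m) * (laguerreCoeff c (m + 1) (k + 1) * h (k + 1)) =
      ∑ k ∈ Finset.range (m + 1), (c + m + (k + 1 : ℕ)) * laguerreCoeff c m (k + 1) * h (k + 1) -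
      ∑ k ∈ Finset.range (m + 1), laguerreCoeff c m k * h (k + 1) := by
    rw [← Finset.sum_sub_distrib]
    refine Finset.sum_congr rfl fun k _ => ?_
    rw [← mul_assoc, laguerreCoeff_succ_succ hc]; push_cast; ring
  have e6 : ∑ k ∈ Finset.range (m + 1), (c + m + (k + 1 : ℕ)) * laguerreCoeff c m (k + 1) * h (k + 1)
      + (c + m + (0 : ℕ)) * laguerreCoeff c m 0 * h 0 =
      ∑ k ∈ Finset.range (m + 1), (c + m + (k : ℕ)) * laguerreCoeff c m k * h k := by
    rw [← Finset.sum_range_succ' (fun k : ℕ => (c + m + (k : ℕ)) * laguerreCoeff c m k * h k),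
      Finset.sum_range_succ, e3]; ring
  have e7 : ∑ k ∈ Finset.range (m + 1), laguerreCoeff c m k * ((c + m + k) * h k - h (k + 1))
      = ∑ k ∈ Finset.range (m + 1), (c + m + (k : ℕ)) * laguerreCoeff c m k * h k -
      ∑ k ∈ Finset.range (m + 1), laguerreCoeff c m k * h (k + 1) := by
    rw [← Finset.sum_sub_distrib]
    exact Finset.sum_congr rfl fun k _ => by ring
  rw [Finset.mul_sum, Finset.sum_range_succ', e7, e5, ← e6, e4, e4]
  push_cast; ring

/-- The Rodrigues formula `e^t t^{-ν} (d/dt)^m (e^{-t} t^{m+ν}) = m! L_m^{(ν)}(t)`, integrated by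
parts `m` times against `t^{m-1} e^{-y/t}`. In the form below it follows by induction from the
recurrence of the Macdonald integral in the order. -/
theorem sum_laguerreCoeff_mul_macdonaldIntegral {c y : ℝ} (hc : 0 < c) (hy : 0 < y) (m : ℕ) :
    ∑ k ∈ Finset.range (m + 1), laguerreCoeff c m k * macdonaldIntegral (c - 1 + m + k) y =
      (-y) ^ m / (ascPochhammer ℝ m).eval c * macdonaldIntegral (c - 1) y := by
  induction m with
  | zero => simp [laguerreCoeff]
  | succ m ih =>
    have hcm : c + (m : ℝ) ≠ 0 := by positivity
    have hstep : (c + m) * ∑ k ∈ Finset.range (m + 1 + 1),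
        laguerreCoeff c (m + 1) k * macdonaldIntegral (c - 1 + (m + 1 : ℕ) + k) y =
        -y * ∑ k ∈ Finset.range (m + 1),
          laguerreCoeff c m k * macdonaldIntegral (c - 1 + m + k) y := by
      have e1 := mul_sum_laguerreCoeff_succ hc m fun k => macdonaldIntegral (c + m + k) y
      refine (congrArg ((c + m) * ·) (Finset.sum_congr rfl fun k _ => ?_)).trans (e1.trans
        ((Finset.sum_congr rfl fun k _ => ?_).trans (Finset.mul_sum _ _ _).symm))
      · congr 2; push_cast; ring
      · have := macdonaldIntegral_add_one hy (c + m + k)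
        rw [show c - 1 + (m : ℝ) + k = c + m + k - 1 by ring]
        push_cast
        rw [← add_assoc, this]; ring
    rw [ih] at hstep
    rw [← mul_right_inj' hcm, hstep, ascPochhammer_succ_eval, pow_succ]
    have := (ascPochhammer_pos m c hc).ne'
    field_simp

theorem factorial_two_mul_le {c : ℝ} (hc : 1 / 2 ≤ c) (k : ℕ) :
    ((2 * k).factorial : ℝ) ≤ 4 ^ k * (k.factorial * (ascPochhammer ℝ k).eval c) := by
  induction k with
  | zero => simp
  | succ k ih =>
    have hp := (ascPochhammer_pos k c (by linarith)).le
    rw [show 2 * (k + 1) = 2 * k + 1 + 1 by ring, Nat.factorial_succ, Nat.factorial_succ,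
      Nat.factorial_succ, ascPochhammer_succ_eval]
    push_cast
    calc (2 * (k : ℝ) + 1 + 1) * ((2 * k + 1) * ((2 * k).factorial : ℝ))
        ≤ (2 * (k : ℝ) + 1 + 1) * ((2 * (c + k)) *
          (4 ^ k * (k.factorial * (ascPochhammer ℝ k).eval c))) := by
          gcongr
          linarith
      _ = _ := by ring

/-- A majorant for the terms of `J_c(t² β)`. -/
theorem norm_normalizedBesselJ_term_le {c : ℝ} (hc : 1 / 2 ≤ c) {t β : ℝ} (ht : 0 ≤ t) (hβ : 0 ≤ β)
    (k : ℕ) : ‖(-(t ^ 2 * β)) ^ k / ((k.factorial : ℝ) * (ascPochhammer ℝ k).eval c)‖ ≤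
      (16 * β) ^ k * exp (t / 2) := by
  have hp := (ascPochhammer_pos k c (by linarith))
  have h1 := factorial_two_mul_le hc k
  have h2 := Real.pow_div_factorial_le_exp (x := t / 2) (by positivity) (2 * k)
  rw [norm_div, norm_pow, norm_neg, Real.norm_of_nonneg (by positivity),
    Real.norm_of_nonneg (by positivity)]
  have h3 : (t ^ 2 * β) ^ k / ((k.factorial : ℝ) * (ascPochhammer ℝ k).eval c) ≤
      (t ^ 2 * β) ^ k / ((2 * k).factorial / 4 ^ k) := by
    gcongr
    rw [div_le_iff₀' (by positivity)]
    exact h1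
  refine h3.trans ?_
  have h4 : (t ^ 2 * β) ^ k / ((2 * k).factorial / 4 ^ k) =
      (16 * β) ^ k * ((t / 2) ^ (2 * k) / (2 * k).factorial) := by
    rw [pow_mul, mul_pow, mul_pow, div_pow, div_pow, show (16 : ℝ) = 4 * (2 ^ 2) by norm_num, mul_pow]
    have : (2 : ℝ) ^ 2 ≠ 0 := by norm_num
    field_simp
  rw [h4]
  gcongr

theorem summable_normalizedBesselJ_term {c : ℝ} (hc : 1 / 2 ≤ c) (v : ℝ) :
    Summable fun k : ℕ => ‖(-v) ^ k / ((k.factorial : ℝ) * (ascPochhammer ℝ k).eval c)‖ := by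
  refine Summable.of_nonneg_of_le (fun _ => norm_nonneg _) (fun k => ?_)
    (Real.summable_pow_div_factorial (4 * |v|))
  have hp := (ascPochhammer_pos k c (by linarith))
  have h1 := factorial_two_mul_le hc k
  rw [norm_div, norm_pow, norm_neg, Real.norm_of_nonneg (r := (k.factorial : ℝ) * _) (by positivity),
    Real.norm_eq_abs, mul_pow, div_le_div_iff₀ (by positivity) (by positivity)]
  have h2 : (k.factorial : ℝ) ≤ (2 * k).factorial := by
    exact_mod_cast Nat.factorial_le (by omega)
  calc |v| ^ k * (k.factorial : ℝ) ≤ |v| ^ k * (4 ^ k * (k.factorial * (ascPochhammer ℝ k).eval c)) := by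
        gcongr; linarith
    _ = _ := by ring

/-- The generating function of the Laguerre polynomials, by a Cauchy product. -/
theorem hasSum_exp_mul_normalizedBesselJ {c : ℝ} (hc : 1 / 2 ≤ c) (t β : ℝ) :
    HasSum (fun m : ℕ => β ^ m / m.factorial *
      ∑ k ∈ Finset.range (m + 1), laguerreCoeff c m k * t ^ (m + k))
      (exp (β * t) * normalizedBesselJ c (t ^ 2 * β)) := by
  have hB := summable_normalizedBesselJ_term hc (t ^ 2 * β)
  have hA := Real.summable_pow_div_factorial (β * t)
  have hA' : Summable fun j : ℕ => ‖(β * t) ^ j / (j.factorial : ℝ)‖ := hA.norm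
  have h1 := tsum_mul_tsum_eq_tsum_sum_range_of_summable_norm hB hA'
  have h2 := (summable_norm_sum_mul_range_of_summable_norm hB hA').of_norm
  have hexp : ∑' j : ℕ, (β * t) ^ j / (j.factorial : ℝ) = exp (β * t) := by
    rw [Real.exp_eq_exp_ℝ, NormedSpace.exp_eq_tsum_div]
  have h3 := h2.hasSum
  rw [← h1, hexp, mul_comm _ (exp (β * t))] at h3
  refine h3.congr_fun fun m => ?_
  rw [Finset.mul_sum]
  refine Finset.sum_congr rfl fun k hk => ?_
  have hk : k ≤ m := by simpa [Nat.lt_succ_iff] using hk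
  obtain ⟨j, rfl⟩ := Nat.exists_eq_add_of_le hk
  rw [laguerreCoeff, Nat.add_sub_cancel_left, Nat.cast_choose ℝ hk, Nat.add_sub_cancel_left]
  have := (ascPochhammer_pos k c (by linarith)).ne'
  have : ((k + j).factorial : ℝ) ≠ 0 := by positivity
  field_simp
  ring

theorem norm_exp_mul_normalizedBesselJ_term_le {c : ℝ} (hc : 1 / 2 ≤ c) {t β : ℝ} (ht : 0 ≤ t)
    (hβ : 0 ≤ β) (m : ℕ) :
    ‖β ^ m / m.factorial * ∑ k ∈ Finset.range (m + 1), laguerreCoeff c m k * t ^ (m + k)‖ ≤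
      (32 * β) ^ m * exp (5 / 8 * t) := by
  rw [Finset.mul_sum]
  have hle : ∀ k ∈ Finset.range (m + 1),
      ‖β ^ m / m.factorial * (laguerreCoeff c m k * t ^ (m + k))‖ ≤
        (16 * β) ^ m * exp (5 / 8 * t) := by
    intro k hk
    have hk : k ≤ m := by simpa [Nat.lt_succ_iff] using hk
    obtain ⟨j, rfl⟩ := Nat.exists_eq_add_of_le hk
    have hp := (ascPochhammer_pos k c (by linarith)).ne'
    have e : β ^ (k + j) / (k + j).factorial * (laguerreCoeff c (k + j) k * t ^ (k + j + k)) =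
        ((-(t ^ 2 * β)) ^ k / ((k.factorial : ℝ) * (ascPochhammer ℝ k).eval c)) *
        ((8 * β) ^ j * ((t / 8) ^ j / j.factorial)) := by
      rw [laguerreCoeff, Nat.cast_choose ℝ hk, Nat.add_sub_cancel_left]
      have : ((k + j).factorial : ℝ) ≠ 0 := by positivity
      rw [div_pow, mul_pow]
      field_simp
      ring
    have h1 := norm_normalizedBesselJ_term_le hc ht hβ k
    have h2 := Real.pow_div_factorial_le_exp (x := t / 8) (by positivity) j
    rw [e, norm_mul, Real.norm_of_nonneg (r := (8 * β) ^ j * _) (by positivity)]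
    calc _ ≤ ((16 * β) ^ k * exp (t / 2)) * ((16 * β) ^ j * exp (t / 8)) := by
          gcongr
          norm_num
      _ = _ := by
          rw [pow_add, show 5 / 8 * t = t / 2 + t / 8 by ring, Real.exp_add]; ring
  refine (norm_sum_le_of_le _ hle).trans ?_
  rw [Finset.sum_const, Finset.card_range, nsmul_eq_mul]
  have h2 : ((m + 1 : ℕ) : ℝ) ≤ 2 ^ m := by exact_mod_cast Nat.lt_two_pow_self
  calc _ ≤ 2 ^ m * ((16 * β) ^ m * exp (5 / 8 * t)) := by gcongr
    _ = _ := by rw [← mul_assoc, ← mul_pow]; ring_nf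

/-- The product `K_{c-1}(2√y) J_{c-1}(2√(yβ))` (up to powers) as a single integral over `t`. The
expansion of `e^{βt} J_{c-1}(2t√β)` in powers of `β` has Laguerre polynomials as coefficients, and these
are integrated one by one with `sum_laguerreCoeff_mul_macdonaldIntegral`. The bound on `β` is not
optimal; it makes the majorants below geometric series. -/
theorem macdonaldIntegral_mul_normalizedBesselJ {c y β : ℝ} (hc : 1 / 2 ≤ c) (hy : 0 < y)
    (hβ : 0 ≤ β) (hβ' : β < 1 / 32) :
    macdonaldIntegral (c - 1) y * normalizedBesselJ c (y * β) =
      ∫ t in Ioi (0 : ℝ), exp (-t - y / t) * t ^ (c - 1 - 1) *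
        (exp (β * t) * normalizedBesselJ c (t ^ 2 * β)) := by
  have hc0 : 0 < c := by linarith
  have hsum : HasSum (fun m : ℕ => ∫ t in Ioi (0 : ℝ), exp (-t - y / t) * t ^ (c - 1 - 1) *
      (β ^ m / m.factorial * ∑ k ∈ Finset.range (m + 1), laguerreCoeff c m k * t ^ (m + k)))
      (∫ t in Ioi (0 : ℝ), exp (-t - y / t) * t ^ (c - 1 - 1) *
        (exp (β * t) * normalizedBesselJ c (t ^ 2 * β))) := by
    refine hasSum_integral_of_dominated_convergence
      (bound := fun m t => (32 * β) ^ m * (exp (-(3 / 8 * t) - y / t) * t ^ (c - 1 - 1)))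
      (fun m => ?_) (fun m => ?_) ?_ ?_ ?_
    · have h1 := aestronglyMeasurable_exp_neg_sub_div_mul_rpow 1 y (c - 1)
      simp only [one_mul] at h1
      exact h1.mul (Continuous.aestronglyMeasurable (by fun_prop))
    · filter_upwards [ae_restrict_mem measurableSet_Ioi] with t ht
      have ht : 0 < t := ht
      rw [norm_mul, Real.norm_of_nonneg (by positivity)]
      calc _ ≤ exp (-t - y / t) * t ^ (c - 1 - 1) * ((32 * β) ^ m * exp (5 / 8 * t)) := by
            gcongr
            exact norm_exp_mul_normalizedBesselJ_term_le hc ht.le hβ m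
        _ = _ := by
            rw [show -(3 / 8 * t) - y / t = (-t - y / t) + 5 / 8 * t by ring, Real.exp_add]; ring
    · refine Eventually.of_forall fun t => Summable.mul_right _ ?_
      exact summable_geometric_of_lt_one (by positivity) (by linarith)
    · simp_rw [tsum_mul_right]
      exact (integrableOn_exp_neg_sub_div_mul_rpow (by norm_num) hy _).const_mul _
    · exact Eventually.of_forall fun t => (hasSum_exp_mul_normalizedBesselJ hc t β).mul_left _
  rw [← hsum.tsum_eq, normalizedBesselJ, ← tsum_mul_left]
  refine tsum_congr fun m => ?_
  have hp := (ascPochhammer_pos m c hc0).ne'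
  have h1 := sum_laguerreCoeff_mul_macdonaldIntegral hc0 hy m
  have h2 : ∀ t ∈ Ioi (0 : ℝ), exp (-t - y / t) * t ^ (c - 1 - 1) *
      (β ^ m / m.factorial * ∑ k ∈ Finset.range (m + 1), laguerreCoeff c m k * t ^ (m + k)) =
      β ^ m / m.factorial * ∑ k ∈ Finset.range (m + 1),
        laguerreCoeff c m k * (exp (-t - y / t) * t ^ (c - 1 + m + k - 1)) := by
    intro t ht
    rw [Finset.mul_sum, Finset.mul_sum, Finset.mul_sum]
    refine Finset.sum_congr rfl fun k _ => ?_
    have ht : 0 < t := ht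
    rw [show c - 1 + (m : ℝ) + k - 1 = (c - 1 - 1) + (m + k : ℕ) by push_cast; ring,
      rpow_add ht, rpow_natCast]
    ring
  rw [setIntegral_congr_fun measurableSet_Ioi h2, integral_const_mul, integral_finsetSum]
  · simp_rw [integral_const_mul]
    have h3 : ∀ k : ℕ, ∫ t in Ioi (0 : ℝ), exp (-t - y / t) * t ^ (c - 1 + m + k - 1) =
        macdonaldIntegral (c - 1 + m + k) y := fun _ => rfl
    simp_rw [h3]
    rw [h1]
    rw [show -(y * β) = (-y) * β by ring, mul_pow]
    field_simp
  · intro k _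
    exact (integrableOn_macdonaldIntegral hy _).const_mul _

theorem Gamma_add_two_mul {l : ℝ} (hl : 0 < l) (k : ℕ) :
    Gamma (l + 2 * k) = Gamma l * (4 ^ k * (ascPochhammer ℝ k).eval (l / 2) *
      (ascPochhammer ℝ k).eval ((l + 1) / 2)) := by
  induction k with
  | zero => simp
  | succ k ih =>
    rw [show l + 2 * ((k + 1 : ℕ) : ℝ) = l + 2 * k + 1 + 1 by push_cast; ring,
      Gamma_add_one (by positivity), Gamma_add_one (by positivity), ih, ascPochhammer_succ_eval,
      ascPochhammer_succ_eval]
    ring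

/-- The Laplace transform of `t^{l-1} J_c(β t²)`. -/
theorem integral_exp_mul_normalizedBesselJ {c l W β : ℝ} (hc : 1 / 2 ≤ c) (hl : 0 < l)
    (hW : 1 / 2 < W) (hβ : 0 ≤ β) (hβ' : β < 1 / 32) :
    ∫ t in Ioi (0 : ℝ), exp (-(W * t)) * t ^ (l - 1) * normalizedBesselJ c (t ^ 2 * β) =
      Gamma l * W ^ (-l) * ordinaryHypergeometric (l / 2) ((l + 1) / 2) c (-(4 * β / W ^ 2)) := by
  have hc0 : 0 < c := by linarith
  have hW0 : 0 < W := by linarith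
  have hsum : HasSum (fun k : ℕ => ∫ t in Ioi (0 : ℝ), exp (-(W * t)) * t ^ (l - 1) *
      ((-(t ^ 2 * β)) ^ k / ((k.factorial : ℝ) * (ascPochhammer ℝ k).eval c)))
      (∫ t in Ioi (0 : ℝ), exp (-(W * t)) * t ^ (l - 1) * normalizedBesselJ c (t ^ 2 * β)) := by
    refine hasSum_integral_of_dominated_convergence
      (bound := fun k t => (16 * β) ^ k * (exp (-((W - 1 / 2) * t)) * t ^ (l - 1)))
      (fun k => ?_) (fun k => ?_) ?_ ?_ ?_
    · have h1 := (integrableOn_exp_neg_mul_rpow hW0 hl).aestronglyMeasurable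
      exact h1.mul (Continuous.aestronglyMeasurable (by fun_prop))
    · filter_upwards [ae_restrict_mem measurableSet_Ioi] with t ht
      have ht : 0 < t := ht
      rw [norm_mul, Real.norm_of_nonneg (by positivity)]
      calc _ ≤ exp (-(W * t)) * t ^ (l - 1) * ((16 * β) ^ k * exp (t / 2)) := by
            gcongr
            exact norm_normalizedBesselJ_term_le hc ht.le hβ k
        _ = _ := by
            rw [show -((W - 1 / 2) * t) = -(W * t) + t / 2 by ring, Real.exp_add]; ring
    · refine Eventually.of_forall fun t => Summable.mul_right _ ?_
      exact summable_geometric_of_lt_one (by positivity) (by linarith)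
    · simp_rw [tsum_mul_right]
      exact (integrableOn_exp_neg_mul_rpow (by linarith) hl).const_mul _
    · exact Eventually.of_forall fun t =>
        ((summable_normalizedBesselJ_term hc (t ^ 2 * β)).of_norm.hasSum).mul_left _
  rw [← hsum.tsum_eq, ordinaryHypergeometric_eq_tsum, ← tsum_mul_left]
  refine tsum_congr fun k => ?_
  have hp := (ascPochhammer_pos k c hc0).ne'
  have h2 : ∀ t ∈ Ioi (0 : ℝ), exp (-(W * t)) * t ^ (l - 1) *
      ((-(t ^ 2 * β)) ^ k / ((k.factorial : ℝ) * (ascPochhammer ℝ k).eval c)) =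
      ((-β) ^ k / ((k.factorial : ℝ) * (ascPochhammer ℝ k).eval c)) *
        (t ^ (l + 2 * k - 1) * exp (-(W * t))) := by
    intro t ht
    have ht : 0 < t := ht
    rw [show l + 2 * (k : ℝ) - 1 = (l - 1) + (2 * k : ℕ) by push_cast; ring,
      rpow_add ht, rpow_natCast, show -(t ^ 2 * β) = t ^ 2 * (-β) by ring, mul_pow, pow_mul]
    ring
  rw [setIntegral_congr_fun measurableSet_Ioi h2, integral_const_mul,
    Real.integral_rpow_mul_exp_neg_mul_Ioi (by positivity) hW0, Gamma_add_two_mul hl,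
    one_div, inv_rpow hW0.le, rpow_add hW0, rpow_neg hW0.le, smul_eq_mul,
    show 2 * (k : ℝ) = ((2 * k : ℕ) : ℝ) by push_cast; ring, rpow_natCast, pow_mul,
    show -(4 * β / W ^ 2) = 4 * (-β) / W ^ 2 by ring, div_pow, mul_pow]
  have : 0 < W ^ l := by positivity
  field_simp

/-! ### Pfaff's transformation of the hypergeometric function -/

/-- The Chu–Vandermonde identity `∑ (-1)^k binom(m,k) (b)_k / (c)_k = (c-b)_m / (c)_m`. -/
theorem sum_laguerreCoeff_mul_ascPochhammer {c : ℝ} (hc : 0 < c) (b : ℝ) (m : ℕ) :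
    ∑ k ∈ Finset.range (m + 1), laguerreCoeff c m k * (ascPochhammer ℝ k).eval b =
      (ascPochhammer ℝ m).eval (c - b) / (ascPochhammer ℝ m).eval c := by
  induction m with
  | zero => simp [laguerreCoeff]
  | succ m ih =>
    have hcm : c + (m : ℝ) ≠ 0 := by positivity
    have h := mul_sum_laguerreCoeff_succ hc m fun k => (ascPochhammer ℝ k).eval b
    have e : ∀ k ∈ Finset.range (m + 1), laguerreCoeff c m k *
        ((c + m + k) * (ascPochhammer ℝ k).eval b - (ascPochhammer ℝ (k + 1)).eval b) =
        (c + m - b) * (laguerreCoeff c m k * (ascPochhammer ℝ k).eval b) := fun k _ => by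
      rw [ascPochhammer_succ_eval]; ring
    rw [Finset.sum_congr rfl e, ← Finset.mul_sum, ih] at h
    rw [← mul_right_inj' hcm, h, ascPochhammer_succ_eval, ascPochhammer_succ_eval]
    have := (ascPochhammer_pos m c hc).ne'
    field_simp
    ring

theorem abs_ascPochhammer_le (a : ℝ) (n : ℕ) :
    |(ascPochhammer ℝ n).eval a| ≤ (ascPochhammer ℝ n).eval |a| := by
  induction n with
  | zero => simp
  | succ n ih =>
    rw [ascPochhammer_succ_eval, ascPochhammer_succ_eval, abs_mul]
    have : |a + n| ≤ |a| + n := (abs_add_le _ _).trans (by simp)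
    gcongr
    exact (abs_nonneg _).trans ih

theorem ascPochhammer_add_eval (a : ℝ) (k j : ℕ) : (ascPochhammer ℝ (k + j)).eval a =
    (ascPochhammer ℝ k).eval a * (ascPochhammer ℝ j).eval (a + k) := by
  rw [← ascPochhammer_mul, Polynomial.eval_mul, Polynomial.eval_comp]
  simp

theorem hasSum_ascPochhammer_rpow (a : ℝ) {x : ℝ} (hx : |x| < 1) :
    HasSum (fun j : ℕ => (ascPochhammer ℝ j).eval a / j.factorial * x ^ j) ((1 - x) ^ (-a)) := by
  have h := (Real.one_div_one_sub_rpow_hasFPowerSeriesOnBall_zero a).hasSum (y := x) (by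
    simpa [Metric.mem_eball, edist_dist] using hx)
  have hx1 : 0 ≤ 1 - x := by linarith [(abs_lt.1 hx).2]
  rw [zero_add, one_div, ← rpow_neg hx1] at h
  convert! h using 2 with j
  simp only [FormalMultilinearSeries.ofScalars_apply_eq, smul_eq_mul]
  congr 1
  have h2 := Ring.factorial_nsmul_multichoose_eq_ascPochhammer a j
  rw [Ring.multichoose_eq, nsmul_eq_mul] at h2
  rw [div_eq_iff (by positivity), mul_comm, h2, Polynomial.ascPochhammer_smeval_eq_eval]

/-- The quotient of successive terms tends to `1`; any base above `1` would do. -/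
theorem exists_ascPochhammer_div_le {c : ℝ} (hc : 0 < c) (b : ℝ) :
    ∃ C, 0 ≤ C ∧ ∀ k : ℕ, |(ascPochhammer ℝ k).eval b / (ascPochhammer ℝ k).eval c| ≤ C * 2 ^ k := by
  set v : ℕ → ℝ := fun k =>
    |(ascPochhammer ℝ k).eval b / (ascPochhammer ℝ k).eval c| / 2 ^ k with hv
  obtain ⟨N, hN⟩ := exists_nat_gt |b|
  obtain ⟨C, hC⟩ := exists_bound_of_antitone_from (v := v) N (fun m hm => by
    have hm' : (N : ℝ) ≤ m := by exact_mod_cast hm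
    have h1 : |b + m| ≤ 2 * (c + m) := by
      have : |b + m| ≤ |b| + m := (abs_add_le _ _).trans (by simp)
      linarith
    have hp := ascPochhammer_pos m c hc
    have hcm : 0 < c + m := by positivity
    simp only [hv]
    rw [ascPochhammer_succ_eval, ascPochhammer_succ_eval, abs_div, abs_div, abs_mul,
      abs_of_pos hp, abs_of_pos (mul_pos hp hcm), pow_succ, div_div, div_div,
      div_le_div_iff₀ (by positivity) (by positivity)]
    calc |(ascPochhammer ℝ m).eval b| * |b + m| * ((ascPochhammer ℝ m).eval c * 2 ^ m)
        ≤ |(ascPochhammer ℝ m).eval b| * (2 * (c + m)) * ((ascPochhammer ℝ m).eval c * 2 ^ m) := by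
          gcongr
      _ = _ := by ring)
  have hv0 : 0 ≤ v 0 := by positivity
  refine ⟨C, hv0.trans (hC 0), fun k => ?_⟩
  have := hC k
  simp only [hv] at this
  rwa [div_le_iff₀ (by positivity)] at this

/-- **Pfaff's transformation** near the origin. Both sides are iterated sums of the double series
`∑ (a)_{k+j} (-1)^k (b)_k / (k! j! (c)_k) x^{k+j}`, which converges absolutely for `|x| < 1/3`. -/
theorem ordinaryHypergeometric_pfaff {a b c x : ℝ} (hc : 0 < c) (hx : |x| < 1 / 3) :
    ordinaryHypergeometric a (c - b) c x =
      (1 - x) ^ (-a) * ordinaryHypergeometric a b c (-(x / (1 - x))) := by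
  have hx1 : 0 < 1 - x := by linarith [(abs_lt.1 hx).2]
  set f : ℕ × ℕ → ℝ := fun u => (ascPochhammer ℝ (u.1 + u.2)).eval a / (u.1.factorial * u.2.factorial)
    * ((-1) ^ u.1 * ((ascPochhammer ℝ u.1).eval b / (ascPochhammer ℝ u.1).eval c)) * x ^ (u.1 + u.2)
    with hf
  have hsumm : Summable f := by
    obtain ⟨C, hC0, hC⟩ := exists_ascPochhammer_div_le hc b
    set g : ℕ × ℕ → ℝ := fun u => (C * (ascPochhammer ℝ u.1).eval |a| / u.1.factorial * (2 * |x|) ^ u.1)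
      * ((ascPochhammer ℝ u.2).eval (|a| + u.1) / u.2.factorial * |x| ^ u.2) with hg
    have hx3 : |(|x|)| < 1 := by rw [abs_abs]; linarith
    have hasc : ∀ (k : ℕ) (s : ℝ), 0 ≤ s → 0 ≤ (ascPochhammer ℝ k).eval s := fun k s hs => by
      have := (abs_nonneg _).trans (abs_ascPochhammer_le s k)
      rwa [abs_of_nonneg hs] at this
    have hgs : Summable g := by
      rw [summable_prod_of_nonneg]
      · have hin : ∀ k : ℕ, HasSum (fun j => g (k, j)) ((C * (ascPochhammer ℝ k).eval |a| /
            k.factorial * (2 * |x|) ^ k) * (1 - |x|) ^ (-(|a| + k))) := fun k =>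
          (hasSum_ascPochhammer_rpow (|a| + k) hx3).mul_left _
        refine ⟨fun k => (hin k).summable, ?_⟩
        simp_rw [fun k => (hin k).tsum_eq]
        have h1 : 0 < 1 - |x| := by linarith
        have h2 : |2 * |x| / (1 - |x|)| < 1 := by
          rw [abs_of_nonneg (by positivity), div_lt_one h1]; linarith
        refine ((hasSum_ascPochhammer_rpow |a| h2).summable.mul_left
          (C * (1 - |x|) ^ (-|a|))).congr fun k => ?_
        rw [neg_add, rpow_add h1, rpow_neg h1.le (k : ℝ), rpow_natCast, div_pow]
        field_simp
      · intro u
        have := hasc u.1 |a| (abs_nonneg _)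
        have := hasc u.2 (|a| + u.1) (by positivity)
        simp only [hg, Pi.zero_apply]
        positivity
    refine Summable.of_norm_bounded hgs fun u => ?_
    have h1 := abs_ascPochhammer_le a (u.1 + u.2)
    have h2 := hC u.1
    have h3 := hasc (u.1 + u.2) |a| (abs_nonneg _)
    simp only [hf, norm_mul, norm_div, norm_pow, norm_neg, norm_one, one_pow, one_mul,
      Real.norm_eq_abs, Nat.abs_cast]
    rw [abs_div] at h2
    calc _ ≤ (ascPochhammer ℝ (u.1 + u.2)).eval |a| / (u.1.factorial * u.2.factorial) *
          (C * 2 ^ u.1) * |x| ^ (u.1 + u.2) := by gcongr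
      _ = _ := by
        simp only [hg]
        rw [ascPochhammer_add_eval, pow_add, mul_pow]
        field_simp
  have hleft : ∑' u, f u = ordinaryHypergeometric a (c - b) c x := by
    rw [← Finset.HasAntidiagonal.sigmaAntidiagonalEquivProd.tsum_eq f, ordinaryHypergeometric_eq_tsum]
    have hs := Finset.HasAntidiagonal.sigmaAntidiagonalEquivProd.summable_iff.2 hsumm
    refine (hs.tsum_sigma' fun n => (hasSum_fintype _).summable).trans ?_
    refine tsum_congr fun n => ?_
    rw [tsum_fintype]
    refine (Finset.sum_coe_sort (Finset.HasAntidiagonal.antidiagonal n) f).trans ?_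
    rw [Finset.Nat.sum_antidiagonal_eq_sum_range_succ_mk]
    have h1 := sum_laguerreCoeff_mul_ascPochhammer hc b n
    have h2 : ∀ k ∈ Finset.range n.succ, f (k, n - k) =
        ((n.factorial : ℝ)⁻¹ * (ascPochhammer ℝ n).eval a * x ^ n) *
          (laguerreCoeff c n k * (ascPochhammer ℝ k).eval b) := by
      intro k hk
      have hk : k ≤ n := by simpa [Nat.lt_succ_iff] using hk
      simp only [hf, laguerreCoeff]
      rw [Nat.add_sub_cancel' hk, Nat.cast_choose ℝ hk]
      have := (ascPochhammer_pos k c hc).ne'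
      have : (n.factorial : ℝ) ≠ 0 := by positivity
      field_simp
    rw [Finset.sum_congr rfl h2, ← Finset.mul_sum, h1, smul_eq_mul]
    ring
  have hright : ∑' u, f u = (1 - x) ^ (-a) * ordinaryHypergeometric a b c (-(x / (1 - x))) := by
    have hin : ∀ k : ℕ, HasSum (fun j => f (k, j)) (((ascPochhammer ℝ k).eval a / k.factorial *
        ((-1) ^ k * ((ascPochhammer ℝ k).eval b / (ascPochhammer ℝ k).eval c)) * x ^ k) *
          (1 - x) ^ (-(a + k))) := fun k => by
      refine ((hasSum_ascPochhammer_rpow (a + k) (by linarith)).mul_left _).congr_fun fun j => ?_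
      simp only [hf]
      rw [ascPochhammer_add_eval, pow_add]
      field_simp
    rw [hsumm.tsum_prod' fun k => (hin k).summable, ordinaryHypergeometric_eq_tsum, ← tsum_mul_left]
    refine tsum_congr fun k => ?_
    rw [(hin k).tsum_eq, neg_add, rpow_add hx1, rpow_neg hx1.le (k : ℝ), rpow_natCast,
      neg_pow (x / (1 - x)), div_pow, smul_eq_mul]
    field_simp
  rw [← hleft, hright]

theorem one_le_radius_ordinaryHypergeometricSeries (a b c : ℝ) :
    1 ≤ (ordinaryHypergeometricSeries ℝ a b c).radius := by
  by_cases h : ∀ kn : ℕ, ↑kn ≠ -a ∧ ↑kn ≠ -b ∧ ↑kn ≠ -c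
  · rw [ordinaryHypergeometricSeries_radius_eq_one ℝ a b c h]
  · push Not at h
    obtain ⟨k, hk⟩ := h
    by_cases h1 : (k : ℝ) = -a
    · rw [show a = -(k : ℝ) by linarith, ordinaryHypergeometric_radius_top_of_neg_nat₁]; simp
    by_cases h2 : (k : ℝ) = -b
    · rw [show b = -(k : ℝ) by linarith, ordinaryHypergeometric_radius_top_of_neg_nat₂]; simp
    · rw [show c = -(k : ℝ) by linarith [hk h1 h2], ordinaryHypergeometric_radius_top_of_neg_nat₃]
      simp

theorem analyticOnNhd_ordinaryHypergeometric (a b c : ℝ) :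
    AnalyticOnNhd ℝ (ordinaryHypergeometric a b c : ℝ → ℝ) (Ioo (-1) 1) := by
  have h1 := one_le_radius_ordinaryHypergeometricSeries a b c
  have h := (ordinaryHypergeometricSeries ℝ a b c).hasFPowerSeriesOnBall (lt_of_lt_of_le one_pos h1)
  intro x hx
  refine h.analyticAt_of_mem ?_
  refine Metric.eball_subset_eball h1 ?_
  simpa [Metric.mem_eball, edist_dist, abs_lt] using hx

/-! ### The zonal harmonic polynomial -/

theorem ascPochhammer_mul_ascPochhammer_eq_zero {l k : ℕ} (h : l / 2 < k) :
    (ascPochhammer ℝ k).eval (-(l : ℝ) / 2) * (ascPochhammer ℝ k).eval ((1 - (l : ℝ)) / 2) = 0 := by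
  rcases Nat.even_or_odd' l with ⟨m, rfl | rfl⟩
  · rw [(ascPochhammer_eval_eq_zero_iff k _).2 ⟨m, by omega, by push_cast; ring⟩, zero_mul]
  · rw [(ascPochhammer_eval_eq_zero_iff k ((1 - ((2 * m + 1 : ℕ) : ℝ)) / 2)).2
      ⟨m, by omega, by push_cast; ring⟩, mul_zero]

/-- The zonal harmonic polynomial of degree `l` on `ℝ^(2c+1)`, as a function of the coordinate `W`
along the axis and of the square `B` of the distance from the axis. -/
noncomputable def zonalHarmonic (c : ℝ) (l : ℕ) (W B : ℝ) : ℝ :=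
  ∑ k ∈ Finset.range (l / 2 + 1), (k.factorial : ℝ)⁻¹ * (ascPochhammer ℝ k).eval (-(l : ℝ) / 2) *
    (ascPochhammer ℝ k).eval ((1 - (l : ℝ)) / 2) * ((ascPochhammer ℝ k).eval c)⁻¹ *
    ((-B) ^ k * W ^ (l - 2 * k))

theorem ordinaryHypergeometric_eq_sum (c : ℝ) (l : ℕ) (x : ℝ) :
    ordinaryHypergeometric (-(l : ℝ) / 2) ((1 - (l : ℝ)) / 2) c x =
      ∑ k ∈ Finset.range (l / 2 + 1), (k.factorial : ℝ)⁻¹ * (ascPochhammer ℝ k).eval (-(l : ℝ) / 2) *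
        (ascPochhammer ℝ k).eval ((1 - (l : ℝ)) / 2) * ((ascPochhammer ℝ k).eval c)⁻¹ * x ^ k := by
  rw [ordinaryHypergeometric_eq_tsum]
  refine tsum_eq_sum fun k hk => ?_
  have hk : l / 2 < k := by simpa [Nat.lt_succ_iff] using hk
  rw [mul_assoc ((k.factorial : ℝ)⁻¹), ascPochhammer_mul_ascPochhammer_eq_zero hk]
  simp

theorem zonalHarmonic_eq (c : ℝ) (l : ℕ) {W : ℝ} (hW : W ≠ 0) (B : ℝ) :
    zonalHarmonic c l W B =
      W ^ l * ordinaryHypergeometric (-(l : ℝ) / 2) ((1 - (l : ℝ)) / 2) c (-(B / W ^ 2)) := by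
  rw [ordinaryHypergeometric_eq_sum, zonalHarmonic, Finset.mul_sum]
  refine Finset.sum_congr rfl fun k hk => ?_
  have hk : 2 * k ≤ l := by
    have : k < l / 2 + 1 := by simpa using hk
    omega
  have : (-B) ^ k * W ^ (l - 2 * k) = W ^ l * (-(B / W ^ 2)) ^ k := by
    rw [pow_sub₀ _ hW hk, show -(B / W ^ 2) = (-B) / W ^ 2 by ring, div_pow, ← pow_mul]
    field_simp
  rw [this]; ring

/-- In the terminating case Pfaff's transformation extends to `(-1, 1)` by analyticity. -/
theorem ordinaryHypergeometric_pfaff_terminating {c x : ℝ} (hc : 0 < c) (l : ℕ)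
    (hx : x ∈ Ioo (-1 : ℝ) 1) :
    ordinaryHypergeometric (-(l : ℝ) / 2) (c - (1 - (l : ℝ)) / 2) c x =
      (1 - x) ^ ((l : ℝ) / 2) *
        ordinaryHypergeometric (-(l : ℝ) / 2) ((1 - (l : ℝ)) / 2) c (-(x / (1 - x))) := by
  have hr : AnalyticOnNhd ℝ (fun x : ℝ => (1 - x) ^ ((l : ℝ) / 2) *
      ordinaryHypergeometric (-(l : ℝ) / 2) ((1 - (l : ℝ)) / 2) c (-(x / (1 - x)))) (Ioo (-1) 1) := by
    simp_rw [ordinaryHypergeometric_eq_sum]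
    intro x hx
    have hx1 : 0 < 1 - x := by linarith [hx.2]
    refine AnalyticAt.mul ?_ (Finset.analyticAt_fun_sum _ fun k _ => ?_)
    · have : (fun x : ℝ => (1 - x) ^ ((l : ℝ) / 2)) =ᶠ[𝓝 x]
          fun x => exp (log (1 - x) * ((l : ℝ) / 2)) := by
        filter_upwards [gt_mem_nhds hx.2] with y hy
        rw [rpow_def_of_pos (by linarith)]
      refine AnalyticAt.congr ?_ this.symm
      have h1 : AnalyticAt ℝ (fun x : ℝ => 1 - x) x := by fun_prop
      exact ((h1.log hx1).mul analyticAt_const).rexp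
    · have h1 : AnalyticAt ℝ (fun x : ℝ => -(x / (1 - x))) x :=
        (analyticAt_id.div (by fun_prop) hx1.ne').neg
      exact analyticAt_const.mul (h1.pow k)
  have hl := analyticOnNhd_ordinaryHypergeometric (-(l : ℝ) / 2) (c - (1 - (l : ℝ)) / 2) c
  refine hl.eqOn_of_preconnected_of_eventuallyEq hr isPreconnected_Ioo (z₀ := 0) (by simp) ?_ hx
  filter_upwards [Metric.ball_mem_nhds (0 : ℝ) (show (0 : ℝ) < 1 / 3 by norm_num)] with y hy
  rw [ordinaryHypergeometric_pfaff hc (by simpa using hy)]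
  congr 2; ring

/-- The generating function is the zonal harmonic polynomial; the sign accounts for the parity of
`W^l`. -/
theorem sign_mul_ordinaryHypergeometric_eq {c τ W B : ℝ} (hc : 0 < c) (l : ℕ) (hτ : 0 < τ)
    (hW : W ≠ 0) (hB : 0 ≤ B) (h : τ ^ 2 = W ^ 2 + B) :
    (if 0 ≤ W then 1 else (-1) ^ l) *
      ordinaryHypergeometric (-(l : ℝ) / 2) (c - (1 - (l : ℝ)) / 2) c (B / τ ^ 2) =
      zonalHarmonic c l W B / τ ^ l := by
  have hτ2 : 0 < τ ^ 2 := by positivity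
  have hW2 : 0 < W ^ 2 := by positivity
  have h1 : 1 - B / τ ^ 2 = (|W| / τ) ^ 2 := by
    rw [div_pow, sq_abs]; field_simp; linarith
  have h2 : B / τ ^ 2 / (1 - B / τ ^ 2) = B / W ^ 2 := by
    rw [h1, div_pow, sq_abs]; field_simp
  have hx : B / τ ^ 2 ∈ Ioo (-1 : ℝ) 1 := by
    constructor
    · have : 0 ≤ B / τ ^ 2 := by positivity
      linarith
    · rw [div_lt_one hτ2]; linarith
  rw [ordinaryHypergeometric_pfaff_terminating hc l hx, h2, h1, zonalHarmonic_eq c l hW,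
    ← rpow_natCast (|W| / τ) 2, ← rpow_mul (by positivity)]
  rw [show ((2 : ℕ) : ℝ) * ((l : ℝ) / 2) = l by push_cast; ring, rpow_natCast, div_pow]
  have h3 : (if 0 ≤ W then (1 : ℝ) else (-1) ^ l) * |W| ^ l = W ^ l := by
    split_ifs with h0
    · rw [abs_of_nonneg h0, one_mul]
    · rw [← mul_pow, abs_of_neg (not_le.1 h0)]; simp
  rw [← h3]; ring

/-- Near the axis, the Laplace transform of the Bessel function is the zonal harmonic polynomial
divided by a power of the radius (a Kelvin transform): both are obtained from the same function
by Pfaff's transformation. -/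
theorem rpow_mul_ordinaryHypergeometric_eq {c τ W B lam : ℝ} (hc : 0 < c) (l : ℕ) (hτ : 0 < τ)
    (hW : 0 < W) (hB : 0 ≤ B) (h : τ ^ 2 = W ^ 2 + B) (hB3 : B / τ ^ 2 < 1 / 3)
    (hlam : lam / 2 = c - (1 - (l : ℝ)) / 2) :
    W ^ (-lam) * ordinaryHypergeometric (lam / 2) ((lam + 1) / 2) c (-(B / W ^ 2)) =
      τ ^ (-lam) * (zonalHarmonic c l W B / τ ^ l) := by
  have hτ2 : 0 < τ ^ 2 := by positivity
  have h1 : 1 - B / τ ^ 2 = (W / τ) ^ 2 := by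
    rw [div_pow]; field_simp; linarith
  have h2 : B / τ ^ 2 / (1 - B / τ ^ 2) = B / W ^ 2 := by
    rw [h1, div_pow]; field_simp
  have h3 := ordinaryHypergeometric_pfaff (a := lam / 2) (b := (lam + 1) / 2) hc
    (x := B / τ ^ 2) (by rwa [abs_of_nonneg (by positivity)])
  have h4 := sign_mul_ordinaryHypergeometric_eq hc l hτ hW.ne' hB h
  rw [if_pos hW.le, one_mul, ← hlam] at h4
  have h5 : ordinaryHypergeometric (-(l : ℝ) / 2) (lam / 2) c (B / τ ^ 2) =
      ordinaryHypergeometric (lam / 2) (c - (lam + 1) / 2) c (B / τ ^ 2) := by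
    rw [ordinaryHypergeometric, ordinaryHypergeometricSeries_symm, ← ordinaryHypergeometric]
    congr 1; linarith
  rw [← h4, h5, h3, h2, h1, ← rpow_natCast (W / τ) 2, ← rpow_mul (by positivity),
    show ((2 : ℕ) : ℝ) * -(lam / 2) = -lam by push_cast; ring, div_rpow hW.le hτ.le]
  have : 0 < τ ^ (-lam) := by positivity
  field_simp

/-! ### The radial integral -/

theorem integrableOn_pow_mul_exp_neg_sq_div {a t : ℝ} (ha : 0 < a) (ht : 0 < t) (m : ℕ) :
    IntegrableOn (fun s : ℝ => s ^ m * exp (-(a * s ^ 2 / t))) (Ioi 0) := by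
  have h := integrableOn_rpow_mul_exp_neg_mul_sq (b := a / t) (by positivity) (s := m)
    (by have : (0 : ℝ) ≤ m := by positivity
        linarith)
  refine h.congr_fun (fun s _ => ?_) measurableSet_Ioi
  simp only [rpow_natCast]
  congr 2; ring

theorem integral_pow_mul_exp_neg_sq_div {a t : ℝ} (ha : 0 < a) (ht : 0 < t) (m : ℕ) :
    ∫ s in Ioi (0 : ℝ), s ^ m * exp (-(a * s ^ 2 / t)) =
      a ^ (-(((m : ℝ) + 1) / 2)) * (1 / 2) * Gamma (((m : ℝ) + 1) / 2) * t ^ (((m : ℝ) + 1) / 2) := by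
  have h := integral_rpow_mul_exp_neg_mul_rpow (p := 2) (q := m) (b := a / t) two_pos
    (by have : (0 : ℝ) ≤ m := by positivity
        linarith) (by positivity)
  have e : ∀ s ∈ Ioi (0 : ℝ), s ^ m * exp (-(a * s ^ 2 / t)) =
      s ^ (m : ℝ) * exp (-(a / t) * s ^ (2 : ℝ)) := fun s _ => by
    rw [rpow_natCast, rpow_two]; congr 2; ring
  rw [setIntegral_congr_fun measurableSet_Ioi e, h, div_rpow ha.le ht.le, neg_div,
    rpow_neg ht.le]
  field_simp

/-- Joint integrability of `s^m exp (-r t - a s²/t) t^(μ-1)` on the quadrant: the integral over `s`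
is a multiple of `t^((m+1)/2)`. -/
theorem integrable_prod_pow_mul_exp {r a μ : ℝ} (hr : 0 < r) (ha : 0 < a) (m : ℕ)
    (hμ : 0 < μ + ((m : ℝ) + 1) / 2) :
    Integrable (fun u : ℝ × ℝ => u.1 ^ m * (exp (-(r * u.2) - a * u.1 ^ 2 / u.2) * u.2 ^ (μ - 1)))
      ((volume.restrict (Ioi 0)).prod (volume.restrict (Ioi 0))) := by
  have hmeas : Measurable fun u : ℝ × ℝ =>
      u.1 ^ m * (exp (-(r * u.2) - a * u.1 ^ 2 / u.2) * u.2 ^ (μ - 1)) := by fun_prop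
  rw [integrable_prod_iff' hmeas.aestronglyMeasurable]
  have hsplit : ∀ s t : ℝ, s ^ m * (exp (-(r * t) - a * s ^ 2 / t) * t ^ (μ - 1)) =
      (s ^ m * exp (-(a * s ^ 2 / t))) * (exp (-(r * t)) * t ^ (μ - 1)) := fun s t => by
    rw [sub_eq_add_neg, Real.exp_add]; ring
  constructor
  · filter_upwards [ae_restrict_mem measurableSet_Ioi] with t ht
    simp_rw [hsplit]
    exact (integrableOn_pow_mul_exp_neg_sq_div ha ht m).mul_const _
  · have h := (integrableOn_exp_neg_mul_rpow hr hμ).const_mul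
      (a ^ (-(((m : ℝ) + 1) / 2)) * (1 / 2) * Gamma (((m : ℝ) + 1) / 2))
    refine h.congr ?_
    filter_upwards [ae_restrict_mem measurableSet_Ioi] with t ht
    have ht : 0 < t := ht
    have e : ∀ s ∈ Ioi (0 : ℝ), ‖s ^ m * (exp (-(r * t) - a * s ^ 2 / t) * t ^ (μ - 1))‖ =
        (s ^ m * exp (-(a * s ^ 2 / t))) * (exp (-(r * t)) * t ^ (μ - 1)) := fun s hs => by
      have hs : 0 < s := hs
      rw [← hsplit, Real.norm_of_nonneg (by positivity)]
    rw [setIntegral_congr_fun measurableSet_Ioi e, integral_mul_const,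
      integral_pow_mul_exp_neg_sq_div ha ht,
      show μ + ((m : ℝ) + 1) / 2 - 1 = (μ - 1) + ((m : ℝ) + 1) / 2 by ring, rpow_add ht]
    ring

theorem measurable_macdonaldIntegral (μ : ℝ) : Measurable (macdonaldIntegral μ) := by
  have h : Measurable fun u : ℝ × ℝ => exp (-u.2 - u.1 / u.2) * u.2 ^ (μ - 1) := by fun_prop
  exact (h.stronglyMeasurable.integral_prod_right' (ν := volume.restrict (Ioi 0))).measurable

/-- The Macdonald function beats an exponential: `s ≤ s²/(2t) + t/2`. -/
theorem integrableOn_pow_mul_macdonaldIntegral_mul_exp {μ : ℝ} (m : ℕ)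
    (hμ : 0 < μ + ((m : ℝ) + 1) / 2) :
    IntegrableOn (fun s : ℝ => s ^ m * macdonaldIntegral μ (s ^ 2) * exp s) (Ioi 0) := by
  have h := (integrable_prod_pow_mul_exp (r := 1 / 2) (a := 1 / 2) (by norm_num) (by norm_num)
    m hμ).integral_prod_left
  have hmeas := measurable_macdonaldIntegral μ
  refine Integrable.mono' h (by fun_prop) ?_
  filter_upwards [ae_restrict_mem measurableSet_Ioi] with s hs
  have hs : 0 < s := hs
  have h0 := macdonaldIntegral_nonneg μ (s ^ 2)
  rw [Real.norm_of_nonneg (by positivity)]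
  have e : s ^ m * macdonaldIntegral μ (s ^ 2) * exp s =
      ∫ t in Ioi (0 : ℝ), s ^ m * (exp (-t - s ^ 2 / t) * t ^ (μ - 1)) * exp s := by
    rw [integral_mul_const, integral_const_mul]; rfl
  rw [e]
  refine setIntegral_mono_on ?_ ?_ measurableSet_Ioi fun t ht => ?_
  · exact ((integrableOn_macdonaldIntegral (by positivity) μ).const_mul _).mul_const _
  · refine (integrableOn_exp_neg_sub_div_mul_rpow (r := 1 / 2) (y := 1 / 2 * s ^ 2)
      (by norm_num) (by positivity) μ).const_mul _
  · have ht : 0 < t := ht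
    have key : -t - s ^ 2 / t + s ≤ -(1 / 2 * t) - 1 / 2 * s ^ 2 / t := by
      have : 0 ≤ (s - t) ^ 2 / (2 * t) := by positivity
      have e2 : (s - t) ^ 2 / (2 * t) = s ^ 2 / t - 1 / 2 * s ^ 2 / t - s + 1 / 2 * t := by
        field_simp; ring
      linarith
    calc s ^ m * (exp (-t - s ^ 2 / t) * t ^ (μ - 1)) * exp s
        = s ^ m * (exp (-t - s ^ 2 / t + s) * t ^ (μ - 1)) := by rw [Real.exp_add]; ring
      _ ≤ _ := by gcongr

section

variable {A : Type*} [NormedAddCommGroup A] [InnerProductSpace ℝ A] [FiniteDimensional ℝ A]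
  [MeasurableSpace A] [BorelSpace A] [Nontrivial A]
  {B : Type*} [NormedAddCommGroup B] [InnerProductSpace ℝ B] [FiniteDimensional ℝ B]
  [MeasurableSpace B] [BorelSpace B] [Nontrivial B]

/-- The product formula, for the Fourier transform of a sphere. -/
theorem macdonaldIntegral_mul_sphereFourier {s : ℝ} (hs : 0 < s) {y : B} (hy : ‖y‖ ^ 2 / 4 < 1 / 32) :
    ((macdonaldIntegral ((Module.finrank ℝ B : ℝ) / 2 - 1) (s ^ 2) : ℝ) : ℂ) * sphereFourier (s • y) =
      ∫ t in Ioi (0 : ℝ), ((exp (-((1 - ‖y‖ ^ 2 / 4) * t) - 1 * s ^ 2 / t) *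
        t ^ ((Module.finrank ℝ B : ℝ) / 2 - 1 - 1) : ℝ) : ℂ) * sphereFourier (t • y) := by
  have hd : (1 : ℝ) ≤ Module.finrank ℝ B := by exact_mod_cast Module.finrank_pos
  have h := macdonaldIntegral_mul_normalizedBesselJ (c := (Module.finrank ℝ B : ℝ) / 2)
    (y := s ^ 2) (β := ‖y‖ ^ 2 / 4) (by linarith) (by positivity) (by positivity) hy
  have hnorm : ∀ t : ℝ, ‖t • y‖ ^ 2 / 4 = t ^ 2 * (‖y‖ ^ 2 / 4) := fun t => by
    rw [norm_smul, mul_pow, Real.norm_eq_abs, sq_abs]; ring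
  simp_rw [sphereFourier_eq, hnorm, ← Complex.ofReal_mul]
  rw [integral_complex_ofReal, mul_left_comm, h, ← integral_const_mul]
  congr 1
  refine setIntegral_congr_fun measurableSet_Ioi fun t _ => ?_
  rw [show -((1 - ‖y‖ ^ 2 / 4) * t) - 1 * s ^ 2 / t = (-t - s ^ 2 / t) + ‖y‖ ^ 2 / 4 * t by ring,
    Real.exp_add]
  ring

/-- The Fourier transform of the cone measure in polar coordinates, close to the axis `y = 0`:
the product formula turns the two Bessel functions into a single one, and the remaining
`s`-integral is the Fourier transform of a Gaussian. -/
theorem integral_macdonaldIntegral_mul_sphereFourier {lam : ℝ} (x : A) {y : B}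
    (hlam : lam = (Module.finrank ℝ A : ℝ) / 2 + ((Module.finrank ℝ B : ℝ) / 2 - 1)) (hlam0 : 0 < lam)
    (hy : ‖y‖ ^ 2 / 4 < 1 / 32) :
    ∫ s in Ioi (0 : ℝ), ((s ^ (Module.finrank ℝ A - 1) *
        macdonaldIntegral ((Module.finrank ℝ B : ℝ) / 2 - 1) (s ^ 2) : ℝ) : ℂ) *
          (sphereFourier (s • x) * sphereFourier (s • y)) =
      ((π ^ ((Module.finrank ℝ A : ℝ) / 2) *
        (2 * π ^ ((Module.finrank ℝ B : ℝ) / 2) / Gamma ((Module.finrank ℝ B : ℝ) / 2)) *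
        (Gamma lam * ((1 + (‖x‖ ^ 2 - ‖y‖ ^ 2) / 4) ^ (-lam) *
          ordinaryHypergeometric (lam / 2) ((lam + 1) / 2) ((Module.finrank ℝ B : ℝ) / 2)
          (-(‖y‖ ^ 2 / (1 + (‖x‖ ^ 2 - ‖y‖ ^ 2) / 4) ^ 2)))) : ℝ) : ℂ) := by
  have hdA : (1 : ℝ) ≤ Module.finrank ℝ A := by exact_mod_cast Module.finrank_pos
  have hdB : (1 : ℝ) ≤ Module.finrank ℝ B := by exact_mod_cast Module.finrank_pos
  set m := Module.finrank ℝ A with hm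
  set c := (Module.finrank ℝ B : ℝ) / 2 with hc
  set β := ‖y‖ ^ 2 / 4 with hβ
  set W := 1 + (‖x‖ ^ 2 - ‖y‖ ^ 2) / 4 with hW
  have hm1 : (((m - 1 : ℕ) : ℝ) + 1) / 2 = (m : ℝ) / 2 := by
    have hm0 : 1 ≤ m := Module.finrank_pos
    rw [Nat.cast_sub hm0]; simp
  set G : ℝ × ℝ → ℂ := fun u => ((u.1 ^ (m - 1) * (exp (-((1 - β) * u.2) - 1 * u.1 ^ 2 / u.2) *
    u.2 ^ (c - 1 - 1)) : ℝ) : ℂ) * (sphereFourier (u.1 • x) * sphereFourier (u.2 • y)) with hG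
  have hcA : Continuous (sphereFourier : A → ℂ) := continuous_sphereFourier
  have hcB : Continuous (sphereFourier : B → ℂ) := continuous_sphereFourier
  have hGint : Integrable G ((volume.restrict (Ioi 0)).prod (volume.restrict (Ioi 0))) := by
    refine ((integrable_prod_pow_mul_exp (r := 1 - β) (a := 1) (μ := c - 1) (by linarith) one_pos
      (m - 1) (by rw [hm1]; linarith)).ofReal).mul_bdd
        (c := (volume : Measure A).toSphere.real univ * (volume : Measure B).toSphere.real univ)
        ?_ ?_
    · exact (Continuous.aestronglyMeasurable (by fun_prop))
    · refine Eventually.of_forall fun u => ?_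
      rw [norm_mul]
      exact mul_le_mul (norm_sphereFourier_le _) (norm_sphereFourier_le _) (norm_nonneg _)
        measureReal_nonneg
  have h1 : ∀ s ∈ Ioi (0 : ℝ), ((s ^ (m - 1) * macdonaldIntegral (c - 1) (s ^ 2) : ℝ) : ℂ) *
      (sphereFourier (s • x) * sphereFourier (s • y)) = ∫ t in Ioi (0 : ℝ), G (s, t) := by
    intro s hs
    have h : ((macdonaldIntegral (c - 1) (s ^ 2) : ℝ) : ℂ) * sphereFourier (s • y) =
        ∫ t in Ioi (0 : ℝ), ((exp (-((1 - β) * t) - 1 * s ^ 2 / t) * t ^ (c - 1 - 1) : ℝ) : ℂ) *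
          sphereFourier (t • y) := macdonaldIntegral_mul_sphereFourier hs hy
    rw [Complex.ofReal_mul, show ∀ a b d e : ℂ, a * b * (d * e) = (a * d) * (b * e) by
      intros; ring, h, ← integral_const_mul]
    refine setIntegral_congr_fun measurableSet_Ioi fun t _ => ?_
    simp only [hG]
    push_cast; ring
  rw [setIntegral_congr_fun measurableSet_Ioi h1, integral_integral_swap hGint]
  have h2 : ∀ t ∈ Ioi (0 : ℝ), ∫ s in Ioi (0 : ℝ), G (s, t) =
      ((π ^ ((m : ℝ) / 2) * (2 * π ^ c / Gamma c) *
        (exp (-(W * t)) * t ^ (lam - 1) * normalizedBesselJ c (t ^ 2 * β)) : ℝ) : ℂ) := by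
    intro t ht
    have ht : 0 < t := ht
    have h := integral_exp_mul_sphereFourier ht x
    have e : ∀ s ∈ Ioi (0 : ℝ), G (s, t) =
        (((exp (-((1 - β) * t)) * t ^ (c - 1 - 1) : ℝ) : ℂ) * sphereFourier (t • y)) *
        (((s ^ (m - 1) * exp (-s ^ 2 / t) : ℝ) : ℂ) * sphereFourier (s • x)) := fun s _ => by
      simp only [hG]
      rw [show -((1 - β) * t) - 1 * s ^ 2 / t = -((1 - β) * t) + -s ^ 2 / t by ring, Real.exp_add]
      push_cast; ring
    have hnorm : ‖t • y‖ ^ 2 / 4 = t ^ 2 * β := by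
      rw [norm_smul, mul_pow, Real.norm_eq_abs, sq_abs]; ring
    rw [setIntegral_congr_fun measurableSet_Ioi e, integral_const_mul, h, sphereFourier_eq, hnorm,
      ← Complex.ofReal_mul, ← Complex.ofReal_mul]
    congr 1
    rw [mul_rpow pi_pos.le ht.le, show lam - 1 = (m : ℝ) / 2 + (c - 1 - 1) by rw [hlam]; ring,
      rpow_add ht, show -(W * t) = -((1 - β) * t) + -t * ‖x‖ ^ 2 / 4 by rw [hW, hβ]; ring,
      Real.exp_add]
    ring
  rw [setIntegral_congr_fun measurableSet_Ioi h2, integral_complex_ofReal, integral_const_mul,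
    integral_exp_mul_normalizedBesselJ (by linarith) hlam0 (by
      have : 0 ≤ ‖x‖ ^ 2 := by positivity
      rw [hW]; linarith) (by positivity) hy]
  rw [show 4 * β = ‖y‖ ^ 2 by rw [hβ]; ring, mul_assoc (Gamma lam)]

end

/-! ### The Bessel density on the cone -/

variable {p q : ℕ}

theorem inner_eq_inner_parts (ζ z : Flat p q) :
    inner ℝ ζ z = inner ℝ (fstPart ζ) (fstPart z) + inner ℝ (sndPart ζ) (sndPart z) := by
  simp only [PiLp.inner_apply, Fintype.sum_sum_type]
  rfl

theorem continuous_fstPart : Continuous (fstPart : Flat p q → _) :=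
  (PiLp.continuous_toLp 2 _).comp (by fun_prop)

theorem continuous_sndPart : Continuous (sndPart : Flat p q → _) :=
  (PiLp.continuous_toLp 2 _).comp (by fun_prop)

theorem fstPart_smul (t : ℝ) (z : Flat p q) : fstPart (t • z) = t • fstPart z := rfl

theorem sndPart_smul (t : ℝ) (z : Flat p q) : sndPart (t • z) = t • sndPart z := rfl

theorem fstPart_pair (x : EuclideanSpace ℝ (Fin (p - 1))) (y : EuclideanSpace ℝ (Fin (q - 1))) :
    fstPart (pair x y) = x := rfl

theorem sndPart_pair (x : EuclideanSpace ℝ (Fin (p - 1))) (y : EuclideanSpace ℝ (Fin (q - 1))) :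
    sndPart (pair x y) = y := rfl

theorem continuous_pair : Continuous fun u : EuclideanSpace ℝ (Fin (p - 1)) ×
    EuclideanSpace ℝ (Fin (q - 1)) => (pair u.1 u.2 : Flat p q) := by
  refine (PiLp.continuous_toLp 2 _).comp (continuous_pi fun i => ?_)
  cases i <;> simp only [Sum.elim_inl, Sum.elim_inr] <;> fun_prop

/-- The parameter space `(0, ∞) × (S^(p-2) × S^(q-2))` of the cone. -/
abbrev ConeParam (p q : ℕ) : Type :=
  Ioi (0 : ℝ) × (Metric.sphere (0 : EuclideanSpace ℝ (Fin (p - 1))) 1 ×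
    Metric.sphere (0 : EuclideanSpace ℝ (Fin (q - 1))) 1)

/-- The measure `s^(n-3) ds dω dω'`. -/
noncomputable abbrev coneParamMeasure (p q : ℕ) : Measure (ConeParam p q) :=
  (Measure.volumeIoiPow (p + q - 5)).prod
    ((volume : Measure (EuclideanSpace ℝ (Fin (p - 1)))).toSphere.prod
      (volume : Measure (EuclideanSpace ℝ (Fin (q - 1)))).toSphere)

/-- Polar coordinates `(s, ω, ω') ↦ (sω, sω')` on the cone. -/
noncomputable def conePoint (t : ConeParam p q) : Flat p q :=
  pair (t.1.1 • t.2.1.1) (t.1.1 • t.2.2.1)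

theorem measurable_conePoint : Measurable (conePoint : ConeParam p q → Flat p q) :=
  (continuous_pair.comp (by fun_prop : Continuous fun t : ConeParam p q =>
    (t.1.1 • t.2.1.1, t.1.1 • t.2.2.1))).measurable

theorem deltaQ_eq : deltaQ p q = (2⁻¹ : ENNReal) • (coneParamMeasure p q).map conePoint := rfl

theorem norm_fstPart_conePoint (t : ConeParam p q) : ‖fstPart (conePoint t)‖ = t.1.1 := by
  have h : 0 < t.1.1 := t.1.2
  rw [conePoint, fstPart_pair, norm_smul, norm_eq_of_mem_sphere t.2.1, mul_one,
    Real.norm_of_nonneg h.le]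

theorem norm_sndPart_conePoint (t : ConeParam p q) : ‖sndPart (conePoint t)‖ = t.1.1 := by
  have h : 0 < t.1.1 := t.1.2
  rw [conePoint, sndPart_pair, norm_smul, norm_eq_of_mem_sphere t.2.2, mul_one,
    Real.norm_of_nonneg h.le]

theorem integrable_deltaQ_iff {F : Type*} [NormedAddCommGroup F] {f : Flat p q → F}
    (hf : StronglyMeasurable f) :
    Integrable f (deltaQ p q) ↔ Integrable (fun t => f (conePoint t)) (coneParamMeasure p q) := by
  rw [deltaQ_eq, integrable_smul_measure (by simp) (by simp),
    integrable_map_measure hf.aestronglyMeasurable measurable_conePoint.aemeasurable]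
  rfl

theorem integral_deltaQ {F : Type*} [NormedAddCommGroup F] [NormedSpace ℝ F] {f : Flat p q → F}
    (hf : StronglyMeasurable f) :
    ∫ ζ, f ζ ∂(deltaQ p q) = (2⁻¹ : ℝ) • ∫ t, f (conePoint t) ∂(coneParamMeasure p q) := by
  rw [deltaQ_eq, integral_smul_measure,
    integral_map measurable_conePoint.aemeasurable hf.aestronglyMeasurable]
  simp

theorem ae_deltaQ_of_forall {P : Flat p q → Prop} (hP : MeasurableSet {ζ | P ζ})
    (h : ∀ t, P (conePoint t)) : ∀ᵐ ζ ∂(deltaQ p q), P ζ := by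
  rw [deltaQ_eq]
  refine Measure.ae_smul_measure ?_ _
  rw [ae_map_iff measurable_conePoint.aemeasurable hP]
  exact Eventually.of_forall h

theorem ae_deltaQ_norm_parts :
    ∀ᵐ ζ ∂(deltaQ p q), 0 < ‖fstPart ζ‖ ∧ ‖sndPart ζ‖ = ‖fstPart ζ‖ := by
  have h1 := (continuous_fstPart (p := p) (q := q)).norm.measurable
  have h2 := (continuous_sndPart (p := p) (q := q)).norm.measurable
  refine ae_deltaQ_of_forall ?_ fun t => ?_
  · exact (measurableSet_lt measurable_const h1).inter (measurableSet_eq_fun h2 h1)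
  · rw [norm_fstPart_conePoint, norm_sndPart_conePoint]
    exact ⟨t.1.2, rfl⟩

/-- The radial density `s ↦ s^((3-q)/2) K_((q-3)/2)(2s)`, in the form given by the integral
representation of the Bessel function. -/
noncomputable def besselDensity (q : ℕ) (s : ℝ) : ℝ :=
  2⁻¹ * s ^ (3 - (q : ℝ)) * macdonaldIntegral (((q : ℝ) - 3) / 2) (s ^ 2)

theorem besselDensity_eq (hq : 2 ≤ q) {s : ℝ} (hs : 0 < s) :
    s ^ ((3 - (q : ℝ)) / 2) * besselK (((q : ℝ) - 3) / 2) (2 * s) = besselDensity q s := by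
  have hq' : (2 : ℝ) ≤ q := by exact_mod_cast hq
  rw [besselK_two_mul (by linarith) hs, besselDensity,
    show 3 - (q : ℝ) = (3 - (q : ℝ)) / 2 + -(((q : ℝ) - 3) / 2) by ring, rpow_add hs]
  rw [show (3 - (q : ℝ)) / 2 + -(((q : ℝ) - 3) / 2) = 3 - q by ring]
  ring

theorem besselDensity_nonneg (q : ℕ) {s : ℝ} (hs : 0 ≤ s) : 0 ≤ besselDensity q s := by
  have := macdonaldIntegral_nonneg (((q : ℝ) - 3) / 2) (s ^ 2)
  unfold besselDensity; positivity

theorem measurable_besselDensity (q : ℕ) : Measurable (besselDensity q) := by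
  have := measurable_macdonaldIntegral (((q : ℝ) - 3) / 2)
  unfold besselDensity; fun_prop

theorem pow_mul_besselDensity (hq : 2 ≤ q) (hp : 3 ≤ p) {s : ℝ} (hs : 0 < s) :
    s ^ (p + q - 5) * besselDensity q s =
      2⁻¹ * (s ^ (p - 2) * macdonaldIntegral (((q : ℝ) - 3) / 2) (s ^ 2)) := by
  have h : s ^ (p + q - 5) * s ^ (3 - (q : ℝ)) = s ^ (p - 2) := by
    rw [← rpow_natCast, ← rpow_natCast, ← rpow_add hs, Nat.cast_sub (by omega),
      Nat.cast_sub (by omega)]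
    congr 1; push_cast; ring
  rw [besselDensity, ← h]; ring

/-- The measure `|ζ'|^((3-q)/2) K_((q-3)/2)(2|ζ'|) δ(Q)`. -/
noncomputable def coneMeasure (p q : ℕ) : Measure (Flat p q) :=
  (deltaQ p q).withDensity fun ζ => ENNReal.ofReal (besselDensity q ‖fstPart ζ‖)

theorem measurable_besselDensity_fstPart :
    Measurable fun ζ : Flat p q => besselDensity q ‖fstPart ζ‖ :=
  (measurable_besselDensity q).comp (continuous_fstPart).norm.measurable

theorem integrable_coneMeasure_iff {f : Flat p q → ℂ} :
    Integrable f (coneMeasure p q) ↔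
      Integrable (fun ζ => (besselDensity q ‖fstPart ζ‖ : ℂ) * f ζ) (deltaQ p q) := by
  rw [coneMeasure, integrable_withDensity_iff_integrable_smul'
    measurable_besselDensity_fstPart.ennreal_ofReal (by simp)]
  refine integrable_congr (Eventually.of_forall fun ζ => ?_)
  simp only
  rw [ENNReal.toReal_ofReal (besselDensity_nonneg q (norm_nonneg _)), Complex.real_smul]

theorem integral_coneMeasure (f : Flat p q → ℂ) :
    ∫ ζ, f ζ ∂(coneMeasure p q) = ∫ ζ, (besselDensity q ‖fstPart ζ‖ : ℂ) * f ζ ∂(deltaQ p q) := by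
  rw [coneMeasure, integral_withDensity_eq_integral_toReal_smul
    measurable_besselDensity_fstPart.ennreal_ofReal (by simp)]
  refine integral_congr_ae (Eventually.of_forall fun ζ => ?_)
  simp only
  rw [ENNReal.toReal_ofReal (besselDensity_nonneg q (norm_nonneg _)), Complex.real_smul]

theorem integrable_volumeIoiPow_besselDensity_mul_exp (hq : 2 ≤ q) (hp : 3 ≤ p) :
    Integrable (fun s : Ioi (0 : ℝ) => besselDensity q s * exp s)
      (Measure.volumeIoiPow (p + q - 5)) := by
  have hq' : (2 : ℝ) ≤ q := by exact_mod_cast hq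
  have hp' : (3 : ℝ) ≤ p := by exact_mod_cast hp
  rw [integrable_volumeIoiPow_iff (h := fun s => besselDensity q s * exp s)]
  have h := (integrableOn_pow_mul_macdonaldIntegral_mul_exp (μ := ((q : ℝ) - 3) / 2) (p - 2) (by
    rw [Nat.cast_sub (by omega)]; push_cast; linarith)).const_mul 2⁻¹
  refine IntegrableOn.congr_fun h (fun s hs => ?_) measurableSet_Ioi
  have hs : 0 < s := hs
  simp only [smul_eq_mul]
  rw [← mul_assoc (s ^ _), pow_mul_besselDensity hq hp hs]; ring

theorem integrable_exp_norm_fstPart (hq : 2 ≤ q) (hp : 3 ≤ p) :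
    Integrable (fun ζ : Flat p q => exp ‖fstPart ζ‖) (coneMeasure p q) := by
  have hm : Measurable fun ζ : Flat p q => exp ‖fstPart ζ‖ :=
    continuous_fstPart.norm.rexp.measurable
  rw [coneMeasure, integrable_withDensity_iff_integrable_smul'
    measurable_besselDensity_fstPart.ennreal_ofReal (by simp)]
  have e : (fun ζ : Flat p q => (ENNReal.ofReal (besselDensity q ‖fstPart ζ‖)).toReal •
      exp ‖fstPart ζ‖) = fun ζ => besselDensity q ‖fstPart ζ‖ * exp ‖fstPart ζ‖ := by
    ext ζ
    rw [ENNReal.toReal_ofReal (besselDensity_nonneg q (norm_nonneg _)), smul_eq_mul]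
  have hm2 : StronglyMeasurable fun ζ : Flat p q => besselDensity q ‖fstPart ζ‖ * exp ‖fstPart ζ‖ :=
    (measurable_besselDensity_fstPart.mul hm).stronglyMeasurable
  rw [e, integrable_deltaQ_iff hm2]
  simp only [norm_fstPart_conePoint]
  exact (integrable_volumeIoiPow_besselDensity_mul_exp hq hp).comp_fst _

theorem isFiniteMeasure_coneMeasure (hq : 2 ≤ q) (hp : 3 ≤ p) :
    IsFiniteMeasure (coneMeasure p q) := by
  have h : Integrable (fun _ : Flat p q => (1 : ℝ)) (coneMeasure p q) := by
    refine (integrable_exp_norm_fstPart hq hp).mono' aestronglyMeasurable_const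
      (Eventually.of_forall fun ζ => ?_)
    simp
  rw [integrable_const_iff] at h
  simpa using h

theorem ae_coneMeasure_abs_inner_le (z : Flat p q) :
    ∀ᵐ ζ ∂(coneMeasure p q), |inner ℝ ζ z| ≤ (‖fstPart z‖ + ‖sndPart z‖) * ‖fstPart ζ‖ := by
  refine (withDensity_absolutelyContinuous _ _).ae_le ?_
  filter_upwards [ae_deltaQ_norm_parts] with ζ hζ
  rw [inner_eq_inner_parts]
  have h1 := abs_real_inner_le_norm (fstPart ζ) (fstPart z)
  have h2 := abs_real_inner_le_norm (sndPart ζ) (sndPart z)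
  rw [hζ.2] at h2
  calc _ ≤ _ := abs_add_le _ _
    _ ≤ _ := add_le_add h1 h2
    _ = _ := by ring

/-- The Fourier transform of the measure on the cone. -/
noncomputable def coneFourier (z : Flat p q) : ℂ :=
  ∫ ζ, Complex.exp (Complex.I * (inner ℝ ζ z : ℝ)) ∂(coneMeasure p q)

theorem coneFourier_eq_sphereFourier (hq : 2 ≤ q) (hp : 3 ≤ p) (z : Flat p q) :
    coneFourier z = ((4⁻¹ : ℝ) : ℂ) * ∫ s in Ioi (0 : ℝ),
      ((s ^ (p - 2) * macdonaldIntegral (((q : ℝ) - 3) / 2) (s ^ 2) : ℝ) : ℂ) *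
        (sphereFourier (s • fstPart z) * sphereFourier (s • sndPart z)) := by
  have hfin := isFiniteMeasure_coneMeasure hq hp
  have hexp : StronglyMeasurable fun ζ : Flat p q => Complex.exp (Complex.I * (inner ℝ ζ z : ℝ)) :=
    Continuous.stronglyMeasurable (by fun_prop)
  have hm : StronglyMeasurable fun ζ : Flat p q => (besselDensity q ‖fstPart ζ‖ : ℂ) *
      Complex.exp (Complex.I * (inner ℝ ζ z : ℝ)) :=
    (Complex.measurable_ofReal.comp measurable_besselDensity_fstPart).stronglyMeasurable.mul hexp
  have hint : Integrable (fun ζ : Flat p q => Complex.exp (Complex.I * (inner ℝ ζ z : ℝ)))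
      (coneMeasure p q) :=
    (integrable_const (1 : ℝ)).mono' hexp.aestronglyMeasurable (Eventually.of_forall fun ζ => by
      rw [mul_comm, Complex.norm_exp_ofReal_mul_I])
  rw [integrable_coneMeasure_iff, integrable_deltaQ_iff hm] at hint
  rw [coneFourier, integral_coneMeasure, integral_deltaQ hm]
  have e : ∀ t : ConeParam p q, (besselDensity q ‖fstPart (conePoint t)‖ : ℂ) *
      Complex.exp (Complex.I * (inner ℝ (conePoint t) z : ℝ)) =
      (besselDensity q t.1 : ℂ) *
        (Complex.exp (Complex.I * (inner ℝ t.2.1.1 (t.1.1 • fstPart z) : ℝ)) *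
          Complex.exp (Complex.I * (inner ℝ t.2.2.1 (t.1.1 • sndPart z) : ℝ))) := fun t => by
    rw [norm_fstPart_conePoint, inner_eq_inner_parts, ← Complex.exp_add]
    simp only [conePoint, fstPart_pair, sndPart_pair, inner_smul_left, inner_smul_right]
    push_cast
    simp only [conj_trivial]
    congr 2
    ring
  simp_rw [e] at hint ⊢
  rw [coneParamMeasure, integral_prod _ hint]
  have e2 : ∀ s : Ioi (0 : ℝ), ∫ u : (Metric.sphere (0 : EuclideanSpace ℝ (Fin (p - 1))) 1 ×
    Metric.sphere (0 : EuclideanSpace ℝ (Fin (q - 1))) 1), (besselDensity q s : ℂ) *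
        (Complex.exp (Complex.I * (inner ℝ u.1.1 (s.1 • fstPart z) : ℝ)) *
          Complex.exp (Complex.I * (inner ℝ u.2.1 (s.1 • sndPart z) : ℝ)))
        ∂((volume : Measure (EuclideanSpace ℝ (Fin (p - 1)))).toSphere.prod
      (volume : Measure (EuclideanSpace ℝ (Fin (q - 1)))).toSphere) =
      (besselDensity q s : ℂ) *
        (sphereFourier (s.1 • fstPart z) * sphereFourier (s.1 • sndPart z)) := fun s => by
    rw [integral_const_mul, integral_prod_mul
      (fun ω : Metric.sphere (0 : EuclideanSpace ℝ (Fin (p - 1))) 1 => Complex.exp (Complex.I * (inner ℝ ω.1 (s.1 • fstPart z) : ℝ)))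
      (fun ω : Metric.sphere (0 : EuclideanSpace ℝ (Fin (q - 1))) 1 =>
        Complex.exp (Complex.I * (inner ℝ ω.1 (s.1 • sndPart z) : ℝ)))]
    rfl
  simp_rw [e2]
  rw [integral_volumeIoiPow (p + q - 5) fun s => (besselDensity q s : ℂ) *
        (sphereFourier (s • fstPart z) * sphereFourier (s • sndPart z)), Complex.real_smul,
    show ((4⁻¹ : ℝ) : ℂ) = ((2⁻¹ : ℝ) : ℂ) * ((2⁻¹ : ℝ) : ℂ) by norm_num, mul_assoc]
  congr 1
  rw [← integral_const_mul]
  refine setIntegral_congr_fun measurableSet_Ioi fun s hs => ?_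
  have h := pow_mul_besselDensity hq hp hs
  simp only [Complex.real_smul]
  rw [← mul_assoc, ← Complex.ofReal_mul, h]
  push_cast
  ring

/-! ### Analytic continuation along rays -/

/-- The coordinate `1 + (|z'|² - |z''|²)/4` of `ι(z)` along the last axis. -/
noncomputable def axisCoord (z : Flat p q) : ℝ := 1 + (‖fstPart z‖ ^ 2 - ‖sndPart z‖ ^ 2) / 4

theorem tau_sq_eq_axisCoord (z : Flat p q) : tau z ^ 2 = axisCoord z ^ 2 + ‖sndPart z‖ ^ 2 := by
  rw [tau_sq, axisCoord]; ring

/-- The pull-back of the zonal spherical harmonic of degree `(p-q)/2`, with its conformal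
weight. -/
noncomputable def zonalPullback (z : Flat p q) : ℝ :=
  tau z ^ (-(((p : ℝ) + q - 4) / 2)) * (zonalHarmonic (((q : ℝ) - 1) / 2) ((p - q) / 2)
    (axisCoord z) (‖sndPart z‖ ^ 2) / tau z ^ ((p - q) / 2))

theorem cast_half_sub (hqp : q ≤ p) (hpar : Even (p + q)) :
    (((p - q) / 2 : ℕ) : ℝ) = ((p : ℝ) - q) / 2 := by
  obtain ⟨k, hk⟩ := hpar
  have h : p = q + 2 * ((p - q) / 2) := by omega
  have h2 : (p : ℝ) = q + 2 * (((p - q) / 2 : ℕ) : ℝ) := by exact_mod_cast h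
  linarith

/-- The total mass of the measure on the cone, that is, its Fourier transform at `0`, where
`zonalPullback` is `1`. -/
noncomputable def coneConstant (p q : ℕ) : ℝ :=
  4⁻¹ * (π ^ (((p : ℝ) - 1) / 2) * (2 * π ^ (((q : ℝ) - 1) / 2) / Gamma (((q : ℝ) - 1) / 2)) *
    Gamma (((p : ℝ) + q - 4) / 2))

/-- The bound on `z''` also ensures `|z''|²/τ² < 1/3`, which Pfaff's transformation requires. -/
theorem coneFourier_eq_of_norm_sndPart_lt (hq : 2 ≤ q) (hp : 3 ≤ p) (hqp : q ≤ p)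
    (hpar : Even (p + q)) {z : Flat p q} (hz : ‖sndPart z‖ ^ 2 / 4 < 1 / 32) :
    coneFourier z = ((coneConstant p q * zonalPullback z : ℝ) : ℂ) := by
  have hq' : (2 : ℝ) ≤ q := by exact_mod_cast hq
  have hp' : (3 : ℝ) ≤ p := by exact_mod_cast hp
  have hl := cast_half_sub hqp hpar
  have : Nonempty (Fin (p - 1)) := ⟨⟨0, by omega⟩⟩
  have : Nonempty (Fin (q - 1)) := ⟨⟨0, by omega⟩⟩
  have hfp : ((p - 1 : ℕ) : ℝ) = (p : ℝ) - 1 := by rw [Nat.cast_sub (by omega)]; simp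
  have hfq : ((q - 1 : ℕ) : ℝ) = (q : ℝ) - 1 := by rw [Nat.cast_sub (by omega)]; simp
  have h := integral_macdonaldIntegral_mul_sphereFourier (lam := ((p : ℝ) + q - 4) / 2)
    (fstPart z) (y := sndPart z) (by
      rw [finrank_euclideanSpace_fin, finrank_euclideanSpace_fin, hfp, hfq]; ring)
    (by linarith) hz
  rw [finrank_euclideanSpace_fin, finrank_euclideanSpace_fin, hfp, hfq,
    show p - 1 - 1 = p - 2 by omega, show ((q : ℝ) - 1) / 2 - 1 = ((q : ℝ) - 3) / 2 by ring] at h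
  have hW : 1 - 1 / 32 < axisCoord z := by
    have : 0 ≤ ‖fstPart z‖ ^ 2 := by positivity
    rw [axisCoord]; linarith
  have hB3 : ‖sndPart z‖ ^ 2 / tau z ^ 2 < 1 / 3 := by
    rw [div_lt_iff₀ (by have := tau_pos z; positivity), tau_sq_eq_axisCoord]
    nlinarith
  have h2 := rpow_mul_ordinaryHypergeometric_eq (c := ((q : ℝ) - 1) / 2)
    (lam := ((p : ℝ) + q - 4) / 2) (by linarith) ((p - q) / 2) (tau_pos z)
    (W := axisCoord z) (by linarith) (B := ‖sndPart z‖ ^ 2) (by positivity)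
    (tau_sq_eq_axisCoord z) hB3 (by rw [hl]; ring)
  rw [coneFourier_eq_sphereFourier hq hp, h, ← Complex.ofReal_mul]
  congr 1
  rw [← axisCoord, h2, coneConstant, zonalPullback]
  ring

theorem analyticAt_zonalPullback_smul (z : Flat p q) (t : ℝ) :
    AnalyticAt ℝ (fun t : ℝ => zonalPullback (t • z)) t := by
  have hfst : ∀ t : ℝ, ‖fstPart (t • z)‖ ^ 2 = t ^ 2 * ‖fstPart z‖ ^ 2 := fun t => by
    rw [fstPart_smul, norm_smul, mul_pow, Real.norm_eq_abs, sq_abs]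
  have hsnd : ∀ t : ℝ, ‖sndPart (t • z)‖ ^ 2 = t ^ 2 * ‖sndPart z‖ ^ 2 := fun t => by
    rw [sndPart_smul, norm_smul, mul_pow, Real.norm_eq_abs, sq_abs]
  have hax : ∀ t : ℝ, axisCoord (t • z) =
      1 + (t ^ 2 * ‖fstPart z‖ ^ 2 - t ^ 2 * ‖sndPart z‖ ^ 2) / 4 := fun t => by
    rw [axisCoord, hfst, hsnd]
  have htau : ∀ t : ℝ, tau (t • z) =
      exp (Real.log ((1 + (t ^ 2 * ‖fstPart z‖ ^ 2 - t ^ 2 * ‖sndPart z‖ ^ 2) / 4) ^ 2 +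
        t ^ 2 * ‖sndPart z‖ ^ 2) / 2) := fun t => by
    rw [← hax, ← hsnd, ← tau_sq_eq_axisCoord, Real.log_pow, Nat.cast_ofNat,
      mul_div_cancel_left₀ _ two_ne_zero, Real.exp_log (tau_pos _)]
  have hpos : ∀ t : ℝ, 0 < (1 + (t ^ 2 * ‖fstPart z‖ ^ 2 - t ^ 2 * ‖sndPart z‖ ^ 2) / 4) ^ 2 +
        t ^ 2 * ‖sndPart z‖ ^ 2 := fun t => by
    rw [← hax, ← hsnd, ← tau_sq_eq_axisCoord]; exact pow_pos (tau_pos _) 2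
  have hlog : AnalyticAt ℝ (fun t : ℝ => tau (t • z)) t := by
    simp_rw [htau]
    have h : AnalyticAt ℝ (fun t : ℝ => (1 + (t ^ 2 * ‖fstPart z‖ ^ 2 -
        t ^ 2 * ‖sndPart z‖ ^ 2) / 4) ^ 2 + t ^ 2 * ‖sndPart z‖ ^ 2) t := by fun_prop
    exact ((h.log (hpos t)).div_const).rexp
  have hne : tau (t • z) ≠ 0 := (tau_pos _).ne'
  have hz : AnalyticAt ℝ (fun t : ℝ => zonalHarmonic (((q : ℝ) - 1) / 2) ((p - q) / 2)
      (axisCoord (t • z)) (‖sndPart (t • z)‖ ^ 2)) t := by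
    simp_rw [hax, hsnd, zonalHarmonic]
    refine Finset.analyticAt_fun_sum _ fun k _ => ?_
    fun_prop
  have hrpow : AnalyticAt ℝ (fun t : ℝ => tau (t • z) ^ (-(((p : ℝ) + q - 4) / 2))) t := by
    simp_rw [rpow_def_of_pos (tau_pos _)]
    exact ((hlog.log (tau_pos _)).mul analyticAt_const).rexp
  exact hrpow.mul (hz.div (hlog.pow _) (pow_ne_zero _ hne))

/-- The exponential moments of the measure on the cone give analyticity of its complex
moment-generating function on the imaginary axis. -/
theorem analyticAt_coneFourier_smul (hq : 2 ≤ q) (hp : 3 ≤ p) (z : Flat p q) (t : ℝ) :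
    AnalyticAt ℝ (fun t : ℝ => coneFourier (t • z)) t := by
  set X : Flat p q → ℝ := fun ζ => inner ℝ ζ z with hX
  have e : ∀ t : ℝ, coneFourier (t • z) =
      ProbabilityTheory.complexMGF X (coneMeasure p q) (t * Complex.I) := fun t => by
    rw [coneFourier, ProbabilityTheory.complexMGF]
    congr 1
    ext ζ
    rw [inner_smul_right, hX]
    push_cast
    congr 1
    ring
  set N := ‖fstPart z‖ + ‖sndPart z‖ + 1 with hN
  have hN0 : 0 < N := by positivity
  have hmem : (0 : ℝ) ∈ interior (ProbabilityTheory.integrableExpSet X (coneMeasure p q)) := by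
    rw [mem_interior_iff_mem_nhds]
    filter_upwards [Ioo_mem_nhds (neg_lt_zero.2 (inv_pos.2 hN0)) (inv_pos.2 hN0)] with r hr
    refine (integrable_exp_norm_fstPart hq hp).mono' (Continuous.aestronglyMeasurable
      (by fun_prop)) ?_
    filter_upwards [ae_coneMeasure_abs_inner_le z] with ζ hζ
    rw [Real.norm_of_nonneg (exp_pos _).le]
    refine exp_le_exp.2 ((le_abs_self _).trans ?_)
    rw [abs_mul]
    have hr' : |r| ≤ N⁻¹ := (abs_lt.2 hr).le
    calc |r| * |X ζ| ≤ N⁻¹ * (N * ‖fstPart ζ‖) := by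
          refine mul_le_mul hr' (hζ.trans ?_) (abs_nonneg _) (by positivity)
          gcongr
          rw [hN]; linarith
      _ = ‖fstPart ζ‖ := by field_simp
  have han : AnalyticAt ℂ (ProbabilityTheory.complexMGF X (coneMeasure p q))
      ((t : ℂ) * Complex.I) := ProbabilityTheory.analyticAt_complexMGF (by simpa using hmem)
  simp_rw [e]
  have hlin : AnalyticAt ℝ (fun t : ℝ => (t : ℂ) * Complex.I) t :=
    (Complex.ofRealCLM.analyticAt t).mul analyticAt_const
  exact AnalyticAt.comp (f := fun t : ℝ => (t : ℂ) * Complex.I) (han.restrictScalars (𝕜 := ℝ)) hlin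

/-- The formula for the Fourier transform of the measure on the cone extends from a neighbourhood
of the axis `z'' = 0` to all of `ℝ^n`, since both sides are real-analytic on rays. -/
theorem coneFourier_eq (hq : 2 ≤ q) (hp : 3 ≤ p) (hqp : q ≤ p) (hpar : Even (p + q))
    (z : Flat p q) : coneFourier z = ((coneConstant p q * zonalPullback z : ℝ) : ℂ) := by
  have h1 : AnalyticOnNhd ℝ (fun t : ℝ => coneFourier (t • z)) univ :=
    fun t _ => analyticAt_coneFourier_smul hq hp z t
  have h2 : AnalyticOnNhd ℝ (fun t : ℝ => ((coneConstant p q * zonalPullback (t • z) : ℝ) : ℂ))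
      univ := fun t _ => by
    exact (Complex.ofRealCLM.analyticAt _).comp
      (analyticAt_const.mul (analyticAt_zonalPullback_smul z t))
  have h3 : (fun t : ℝ => coneFourier (t • z)) =ᶠ[𝓝 0]
      fun t : ℝ => ((coneConstant p q * zonalPullback (t • z) : ℝ) : ℂ) := by
    have hc : Continuous fun t : ℝ => ‖sndPart (t • z)‖ ^ 2 / 4 :=
      ((continuous_sndPart.comp (by fun_prop : Continuous fun t : ℝ => t • z)).norm.pow 2).div_const 4
    have hev : ∀ᶠ t : ℝ in 𝓝 0, ‖sndPart (t • z)‖ ^ 2 / 4 < 1 / 32 :=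
      hc.continuousAt.eventually_lt continuousAt_const (by
        rw [sndPart_smul, zero_smul, norm_zero]; norm_num)
    filter_upwards [hev] with t ht
    exact coneFourier_eq_of_norm_sndPart_lt hq hp hqp hpar ht
  have h := h1.eqOn_of_preconnected_of_eventuallyEq h2 isPreconnected_univ (mem_univ 0) h3
    (mem_univ 1)
  simpa using h

/-- The generating function in terms of the zonal harmonic. On `W = 0` the argument `|u''|²` of the
hypergeometric function is `1`, the boundary of its disc of convergence; this null set is left out. -/
theorem twistedPullback_generatingFunction_eq (hq : 2 ≤ q) (hqp : q ≤ p) (hpar : Even (p + q))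
    {z : Flat p q} (hz : axisCoord z ≠ 0) :
    twistedPullback (((p : ℝ) + q - 4) / 2) (generatingFunction p q) z =
      ((zonalPullback z : ℝ) : ℂ) := by
  have hq' : (2 : ℝ) ≤ q := by exact_mod_cast hq
  have hl := cast_half_sub hqp hpar
  have h := sign_mul_ordinaryHypergeometric_eq (c := ((q : ℝ) - 1) / 2) (by linarith)
    ((p - q) / 2) (tau_pos z) hz (B := ‖sndPart z‖ ^ 2) (by positivity) (tau_sq_eq_axisCoord z)
  have hlast : (Psi z).1.2.2.2 = (tau z)⁻¹ * axisCoord z := rfl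
  have hsnd : ‖(Psi z).1.2.2.1‖ ^ 2 = ‖sndPart z‖ ^ 2 / tau z ^ 2 := by
    have : (Psi z).1.2.2.1 = (tau z)⁻¹ • sndPart z := rfl
    rw [this, norm_smul, mul_pow, Real.norm_eq_abs, sq_abs, inv_pow]
    ring
  have hsign : 0 ≤ (tau z)⁻¹ * axisCoord z ↔ 0 ≤ axisCoord z :=
    mul_nonneg_iff_of_pos_left (inv_pos.2 (tau_pos z))
  rw [twistedPullback, generatingFunction, ← Complex.ofReal_mul, zonalPullback, ← h, hlast, hsnd,
    hl]
  simp only [hsign]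
  rw [show ((q : ℝ) - p) / 4 = -(((p : ℝ) - q) / 2) / 2 by ring,
    show ((p : ℝ) + q - 4) / 4 = ((q : ℝ) - 1) / 2 - (1 - ((p : ℝ) - q) / 2) / 2 by ring]

/-- The set in question is a level set of the quadratic form `|z''|² - |z'|²`. Only countably many
of its level sets have positive measure, and by homogeneity all positive levels are null if one
is. -/
theorem ae_axisCoord_ne_zero : ∀ᵐ z : Flat p q, axisCoord z ≠ 0 := by
  set f : Flat p q → ℝ := fun z => ‖sndPart z‖ ^ 2 - ‖fstPart z‖ ^ 2 with hf
  have hfc : Continuous f := (continuous_sndPart.norm.pow 2).sub (continuous_fstPart.norm.pow 2)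
  have hcount := Measure.countable_meas_level_set_pos (μ := (volume : Measure (Flat p q)))
    hfc.measurable
  have hex : ∃ r : ℝ, r ∈ Ioi (0 : ℝ) ∧
      r ∉ {t : ℝ | 0 < (volume : Measure (Flat p q)) {a | f a = t}} := by
    by_contra! hcon
    have h0 := (hcount.mono hcon).measure_zero (volume : Measure ℝ)
    simp at h0
  obtain ⟨r, hr, hr0⟩ := hex
  have hr : 0 < r := hr
  have hr0 : (volume : Measure (Flat p q)) {a | f a = r} = 0 := by simpa using hr0
  have hset : {z : Flat p q | axisCoord z = 0} = (sqrt (r / 4) • ·) ⁻¹' {a | f a = r} := by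
    ext z
    have h1 : f (sqrt (r / 4) • z) = r / 4 * f z := by
      simp only [hf, fstPart_smul, sndPart_smul, norm_smul, mul_pow, Real.norm_eq_abs, sq_abs,
        Real.sq_sqrt (show 0 ≤ r / 4 by positivity)]
      ring
    have h2 : axisCoord z = 1 - f z / 4 := by simp only [axisCoord, hf]; ring
    simp only [mem_ofPred_eq, mem_preimage, h1, h2]
    constructor
    · intro h; rw [show f z = 4 by linarith]; ring
    · intro h; have : f z = 4 := by field_simp at h; linarith
      rw [this]; norm_num
  rw [ae_iff]
  simp only [ne_eq, not_not]
  rw [hset, Measure.addHaar_preimage_smul _ (by positivity), hr0, mul_zero]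

/-! ### Distributions with a prescribed finite measure as Fourier transform -/

theorem IsGivenBy.congr {E : Type*} [NormedAddCommGroup E] [InnerProductSpace ℝ E]
    [MeasurableSpace E] {T : 𝓢'(E, ℂ)} {f g : E → ℂ} {μ : Measure E} (h : IsGivenBy T f μ)
    (hfg : f =ᵐ[μ] g) : IsGivenBy T g μ := fun φ => by
  have h2 : (fun x => f x * φ x) =ᵐ[μ] fun x => g x * φ x := by
    filter_upwards [hfg] with x hx
    rw [hx]
  exact ⟨(h φ).1.congr h2, (h φ).2.trans (integral_congr_ae h2)⟩

section

variable {E : Type*} [NormedAddCommGroup E] [InnerProductSpace ℝ E] [FiniteDimensional ℝ E]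
  [MeasurableSpace E] [BorelSpace E]

/-- The inverse of the Fourier transform `fourierS`; only the left inverse property is needed. -/
noncomputable def fourierSInv (E : Type*) [NormedAddCommGroup E] [InnerProductSpace ℝ E]
    [FiniteDimensional ℝ E] [MeasurableSpace E] [BorelSpace E] : 𝓢(E, ℂ) →L[ℂ] 𝓢(E, ℂ) :=
  (FourierTransform.fourierCLM ℂ 𝓢(E, ℂ)).comp
    (SchwartzMap.compCLMOfContinuousLinearEquiv ℂ (homothety E).symm)

theorem fourierSInv_fourierS (φ : 𝓢(E, ℂ)) : fourierSInv E (fourierS E φ) = φ := by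
  have h : SchwartzMap.compCLMOfContinuousLinearEquiv ℂ (homothety E).symm (fourierS E φ) =
      𝓕⁻ φ := by
    ext x
    simp [fourierS]
  rw [fourierSInv, ContinuousLinearMap.comp_apply, h]
  simp

theorem fourierSInv_apply (φ : 𝓢(E, ℂ)) (ζ : E) :
    fourierSInv E φ ζ = (((2 * π) ^ Module.finrank ℝ E)⁻¹ : ℝ) *
      ∫ y, Complex.exp (-(Complex.I * (inner ℝ ζ y : ℝ))) * φ y := by
  have hsymm : ∀ x : E, (homothety E).symm x = (2 * π) • x := fun x => by
    rw [ContinuousLinearEquiv.symm_apply_eq]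
    have : homothety E ((2 * π) • x) = (2 * π)⁻¹ • ((2 * π) • x) := rfl
    rw [this, smul_smul, inv_mul_cancel₀ (by positivity), one_smul]
  have h : fourierSInv E φ ζ = (𝓕 (fun x : E => φ ((2 * π) • x))) ζ := by
    have h2 : (SchwartzMap.compCLMOfContinuousLinearEquiv ℂ (homothety E).symm φ : E → ℂ) =
        fun x : E => φ ((2 * π) • x) := by
      ext x
      simp [hsymm]
    rw [← h2, ← SchwartzMap.fourier_coe]; rfl
  have h3 := Measure.integral_comp_smul_of_nonneg (volume : Measure E)
    (fun y : E => Complex.exp (-(Complex.I * (inner ℝ ζ y : ℝ))) * φ y) (2 * π)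
    (hR := by positivity)
  rw [h, Real.fourier_eq', ← Complex.real_smul, ← h3]
  refine integral_congr_ae (Eventually.of_forall fun x => ?_)
  simp only [smul_eq_mul, inner_smul_right]
  rw [real_inner_comm]
  congr 2
  push_cast
  ring

/-- A multiple of a finite measure is the Fourier transform of the distribution given by its inverse
Fourier transform, a bounded function. -/
theorem exists_fourierD_eq_smul (μ : Measure E) [IsFiniteMeasure μ] (C : ℂ) :
    ∃ U : 𝓢'(E, ℂ), fourierD U = C • μ.toTemperedDistribution ∧
      IsGivenBy U (fun y => C * ((((2 * π) ^ Module.finrank ℝ E)⁻¹ : ℝ) *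
        ∫ ζ, Complex.exp (-(Complex.I * (inner ℝ ζ y : ℝ))) ∂μ)) volume := by
  refine ⟨PointwiseConvergenceCLM.precomp ℂ (fourierSInv E) (C • μ.toTemperedDistribution), ?_,
    fun φ => ?_⟩
  · ext φ
    change C • μ.toTemperedDistribution (fourierSInv E (fourierS E φ)) =
      C • μ.toTemperedDistribution φ
    rw [fourierSInv_fourierS]
  · have hG : Integrable (fun u : E × E => Complex.exp (-(Complex.I * (inner ℝ u.1 u.2 : ℝ))) *
        φ u.2) (μ.prod volume) := by
      refine (φ.integrable.comp_snd μ).bdd_mul (c := 1)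
        (Continuous.aestronglyMeasurable (by fun_prop)) (Eventually.of_forall fun u => ?_)
      rw [show -(Complex.I * (inner ℝ u.1 u.2 : ℝ)) = ((-(inner ℝ u.1 u.2) : ℝ) : ℂ) * Complex.I by
        push_cast; ring, Complex.norm_exp_ofReal_mul_I]
    have e : ∀ y : E, C * ((((2 * π) ^ Module.finrank ℝ E)⁻¹ : ℝ) *
        ∫ ζ, Complex.exp (-(Complex.I * (inner ℝ ζ y : ℝ))) ∂μ) * φ y =
        (C * (((2 * π) ^ Module.finrank ℝ E)⁻¹ : ℝ)) *
          ∫ ζ, Complex.exp (-(Complex.I * (inner ℝ ζ y : ℝ))) * φ y ∂μ := fun y => by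
      rw [integral_mul_const]; ring
    simp_rw [e]
    refine ⟨hG.integral_prod_right.const_mul _, ?_⟩
    change C • ∫ ζ, fourierSInv E φ ζ ∂μ = _
    rw [integral_const_mul, ← integral_integral_swap hG]
    simp_rw [fourierSInv_apply]
    rw [integral_const_mul, smul_eq_mul, mul_assoc]

end

/-! ### The Fourier transform of the generating function -/

theorem isGivenBy_coneMeasure (hq : 2 ≤ q) [IsFiniteMeasure (coneMeasure p q)] :
    IsGivenBy (coneMeasure p q).toTemperedDistribution
      (fun ζ : Flat p q => ((‖fstPart ζ‖ ^ ((3 - (q : ℝ)) / 2) *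
        besselK (((q : ℝ) - 3) / 2) (2 * ‖fstPart ζ‖) : ℝ) : ℂ)) (deltaQ p q) := by
  have h : IsGivenBy (coneMeasure p q).toTemperedDistribution
      (fun ζ : Flat p q => (besselDensity q ‖fstPart ζ‖ : ℂ)) (deltaQ p q) := fun φ =>
    ⟨integrable_coneMeasure_iff.1 φ.integrable, integral_coneMeasure _⟩
  refine h.congr ?_
  filter_upwards [ae_deltaQ_norm_parts] with ζ hζ
  rw [besselDensity_eq hq hζ.1]

/-- The normalizing constants cancel up to the `(2π)^n` of the Fourier inversion formula. -/
theorem coneConstant_mul (hq : 2 ≤ q) (hp : 3 ≤ p) :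
    (2 * π) ^ (((p : ℝ) + q - 2) / 2) * 2 ^ (((p : ℝ) + q) / 2) *
      (Gamma (((q : ℝ) - 1) / 2) / Gamma (((p : ℝ) + q - 4) / 2)) * coneConstant p q =
      (2 * π) ^ (p - 1 + (q - 1)) := by
  have hq' : (2 : ℝ) ≤ q := by exact_mod_cast hq
  have hp' : (3 : ℝ) ≤ p := by exact_mod_cast hp
  have h1 : Gamma (((q : ℝ) - 1) / 2) ≠ 0 := (Gamma_pos_of_pos (by linarith)).ne'
  have h2 : Gamma (((p : ℝ) + q - 4) / 2) ≠ 0 := (Gamma_pos_of_pos (by linarith)).ne'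
  have h3 : (2 : ℝ) ^ (((p : ℝ) + q) / 2) = 2 ^ (((p : ℝ) + q - 2) / 2) * 2 := by
    rw [show ((p : ℝ) + q) / 2 = ((p : ℝ) + q - 2) / 2 + 1 by ring, rpow_add two_pos, rpow_one]
  have h4 : π ^ (((p : ℝ) - 1) / 2) * π ^ (((q : ℝ) - 1) / 2) = π ^ (((p : ℝ) + q - 2) / 2) := by
    rw [← rpow_add pi_pos]; congr 1; ring
  have h5 : (2 * π) ^ (p - 1 + (q - 1)) =
      (2 * π) ^ (((p : ℝ) + q - 2) / 2) * (2 * π) ^ (((p : ℝ) + q - 2) / 2) := by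
    rw [← rpow_add (by positivity), ← rpow_natCast, Nat.cast_add, Nat.cast_sub (by omega),
      Nat.cast_sub (by omega)]
    congr 1; push_cast; ring
  have h6 : (2 * π) ^ (((p : ℝ) + q - 2) / 2) =
      2 ^ (((p : ℝ) + q - 2) / 2) * π ^ (((p : ℝ) + q - 2) / 2) := mul_rpow two_pos.le pi_pos.le
  rw [h5, h3, coneConstant]
  nth_rewrite 3 [h6]
  rw [← h4]
  field_simp
  norm_num

theorem zonalPullback_neg (z : Flat p q) : zonalPullback (-z) = zonalPullback z := by
  have h1 : ‖fstPart (-z)‖ = ‖fstPart z‖ := norm_neg (fstPart z)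
  have h2 : ‖sndPart (-z)‖ = ‖sndPart z‖ := norm_neg (sndPart z)
  simp only [zonalPullback, axisCoord, tau, h1, h2]

end ConformalCone

theorem theorem5p5 (p q : ℕ) (hq : 2 ≤ q) (hqp : q ≤ p) (hpar : Even (p + q))
    (hpq : (p, q) ≠ (2, 2)) :
    ∃ U V : 𝓢'(ConformalCone.Flat p q, ℂ),
      ConformalCone.IsGivenBy U
        (ConformalCone.twistedPullback (((p : ℝ) + q - 4) / 2)
          (ConformalCone.generatingFunction p q)) volume ∧
      ConformalCone.IsGivenBy V
        (fun ζ => ((‖ConformalCone.fstPart ζ‖ ^ ((3 - (q : ℝ)) / 2) *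
          ConformalCone.besselK (((q : ℝ) - 3) / 2) (2 * ‖ConformalCone.fstPart ζ‖) : ℝ) : ℂ))
        (ConformalCone.deltaQ p q) ∧
      ConformalCone.fourierD U =
        (((2 * Real.pi) ^ (((p : ℝ) + q - 2) / 2) * 2 ^ (((p : ℝ) + q) / 2) *
          (Real.Gamma (((q : ℝ) - 1) / 2) / Real.Gamma (((p : ℝ) + q - 4) / 2)) : ℝ) : ℂ) • V := by
  -- By parity the only pair with `p = 2` is `(2, 2)`.
  have hp : 3 ≤ p := by
    by_contra! hlt
    have h1 : p = 2 := by omega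
    have h2 : q = 2 := by omega
    exact hpq (by rw [h1, h2])
  have hfin := ConformalCone.isFiniteMeasure_coneMeasure (p := p) (q := q) hq hp
  obtain ⟨U, hU, hU2⟩ := ConformalCone.exists_fourierD_eq_smul (ConformalCone.coneMeasure p q)
    (((2 * Real.pi) ^ (((p : ℝ) + q - 2) / 2) * 2 ^ (((p : ℝ) + q) / 2) *
      (Real.Gamma (((q : ℝ) - 1) / 2) / Real.Gamma (((p : ℝ) + q - 4) / 2)) : ℝ) : ℂ)
  -- It remains to compare the functions, off the null set `W = 0`.
  refine ⟨U, _, hU2.congr ?_, ConformalCone.isGivenBy_coneMeasure hq, hU⟩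
  filter_upwards [ConformalCone.ae_axisCoord_ne_zero] with z hz
  have hrank : Module.finrank ℝ (ConformalCone.Flat p q) = p - 1 + (q - 1) := by
    rw [finrank_euclideanSpace, Fintype.card_sum, Fintype.card_fin, Fintype.card_fin]
  have hneg : ∫ ζ, Complex.exp (-(Complex.I * (inner ℝ ζ z : ℝ))) ∂(ConformalCone.coneMeasure p q) =
      ((ConformalCone.coneConstant p q * ConformalCone.zonalPullback z : ℝ) : ℂ) := by
    rw [← ConformalCone.zonalPullback_neg, ← ConformalCone.coneFourier_eq hq hp hqp hpar]
    simp only [ConformalCone.coneFourier, inner_neg_right, Complex.ofReal_neg, mul_neg]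
  rw [ConformalCone.twistedPullback_generatingFunction_eq hq hqp hpar hz, hneg, hrank,
    ← Complex.ofReal_mul, ← Complex.ofReal_mul]
  congr 1
  have h0 : (2 * Real.pi) ^ (p - 1 + (q - 1)) ≠ 0 := by positivity
  rw [mul_left_comm, ← mul_assoc _ (ConformalCone.coneConstant p q),
    ConformalCone.coneConstant_mul hq hp, inv_mul_cancel_left₀ h0]
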